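/- Let $\mathbb{R}^{2,1}$ be $\mathbb{R}^3$ with $\langle x,y\rangle=-x_0y_0+x_1y_1+x_2y_2$, let $\mathbb{H}^2=\{x:\langle x,x\rangle=-1,\ x_0>0\}$ be the hyperbolic plane, and let $S=\mathbb{H}^2/\Gamma$ be a closed hyperbolic surface, where $\Gamma$ is a group of isometries of $\mathbb{H}^2$ (linear isometries of $\mathbb{R}^{2,1}$ preserving $\mathbb{H}^2$) acting freely, properly discontinuously and cocompactly. Consider a finite geodesic triangulation of $S$ and its lift to $\mathbb{H}^2$, with vertex set $V\subset\mathbb{H}^2$. Suppose that it is Delaunay: for any two different triangles $ijk$ and $ijl$ of the lift with a common edge $ij$, the vertex $l$ does not lie strictly inside the circumcycle (circle, horocycle or hypercycle) of $ijk$, where the inside is the side that contains the triangle $ijk$. An infinitesimal deformation of the circle pattern formed by the circumcycles is a family of tangent vectors $\eta_v\in T_v\mathbb{H}^2$, $v\in V$. It preserves the intersection angles if for every smooth motion $p_v(t)\in\mathbb{H}^2$ of the vertices with $p_v(0)=v$, $\dot p_v(0)=\eta_v$, and for every two adjacent triangles $ijk$, $ijl$, the signed intersection angle of their circumcycles $$\arg\left(-\frac{(z_i-z_k)(z_j-z_l)}{(z_i-z_l)(z_j-z_k)}\right)$$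 has zero derivative at $t=0$; here $z_v(t)$ is the image of $p_v(t)$ in the Poincaré disk. It preserves the hyperbolic structure if there is an infinitesimal isometry $A\in\mathfrak{so}(2,1)$ of $\mathbb{H}^2$ such that the field $v\mapsto\eta_v-Av$ is $\Gamma$-equivariant, that is, $\eta_{\gamma v}-A\gamma v=\gamma(\eta_v-Av)$ for all $\gamma\in\Gamma$, $v\in V$. (For $A=0$ this means that the vertices move on the fixed surface $S$.) If $\eta$ preserves the intersection angles and preserves the hyperbolic structure, with infinitesimal isometry $A$, then $\eta$ is trivial: $\eta_v=Av$ for every $v\in V$. In particular, if the vertices move on the fixed surface $S$ ($A=0$), then $\eta_v=0$ for all $v$. -/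

import Mathlib

namespace CirclePattern

/-- The vector space underlying Minkowski space `ℝ^{2,1}`; the coordinate `0` is the timelike one. -/
abbrev Mink : Type := Fin 3 → ℝ

/-- The Minkowski inner product of signature `(2,1)`. -/
def mink (x y : Mink) : ℝ := -(x 0 * y 0) + x 1 * y 1 + x 2 * y 2

/-- The hyperbolic plane: the upper sheet of the hyperboloid. -/
def hypPlane : Set Mink := {x | mink x x = -1 ∧ 0 < x 0}

/-- `Γ` is the deck group of a closed (compact, without boundary, connected) hyperbolic surface
`ℍ² / Γ`: it acts on the hyperbolic plane by isometries, freely, properly discontinuously and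
cocompactly. Orientability is not required. -/
structure IsClosedSurfaceGroup (Γ : Subgroup (Mink ≃ₗ[ℝ] Mink)) : Prop where
  isometry : ∀ γ ∈ Γ, ∀ x y, mink (γ x) (γ y) = mink x y
  mapsTo : ∀ γ ∈ Γ, ∀ x ∈ hypPlane, γ x ∈ hypPlane
  free : ∀ γ ∈ Γ, ∀ x ∈ hypPlane, γ x = x → γ = 1
  properlyDiscontinuous : ∀ K : Set Mink, IsCompact K → K ⊆ hypPlane →
    {γ : Mink ≃ₗ[ℝ] Mink | γ ∈ Γ ∧ (γ '' K ∩ K).Nonempty}.Finite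
  cocompact : ∃ K : Set Mink, IsCompact K ∧ K ⊆ hypPlane ∧
    ∀ x ∈ hypPlane, ∃ γ ∈ Γ, γ x ∈ K

/-- The geodesic simplex in the hyperbolic plane spanned by a set `f` of points: the central
projection to the hyperboloid of the Euclidean convex hull. For one, two or three points it is
a point, a geodesic segment or a closed geodesic triangle. -/
def geodesicSimplex (f : Set Mink) : Set Mink :=
  {x | x ∈ hypPlane ∧ ∃ t : ℝ, 0 < t ∧ t • x ∈ convexHull ℝ f}

/-- `F` is the set of triangles (given by their vertex sets) of the lift to the hyperbolic plane of
a geodesic triangulation of the closed hyperbolic surface `ℍ² / Γ`. Triangulations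
downstairs with loops, multiple edges, or a single vertex are included. -/
structure IsGeodesicTriangulation (Γ : Subgroup (Mink ≃ₗ[ℝ] Mink)) (F : Set (Set Mink)) :
    Prop where
  subset_hypPlane : ∀ f ∈ F, f ⊆ hypPlane
  ncard_eq_three : ∀ f ∈ F, f.ncard = 3
  /-- the three vertices of a triangle do not lie on one geodesic -/
  nondegenerate : ∀ f ∈ F, LinearIndependent ℝ (fun v : f => (v : Mink))
  covers : ∀ x ∈ hypPlane, ∃ f ∈ F, x ∈ geodesicSimplex f
  /-- two triangles meet exactly in the simplex spanned by their common vertices -/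
  face_to_face : ∀ f ∈ F, ∀ g ∈ F,
    geodesicSimplex f ∩ geodesicSimplex g = geodesicSimplex (f ∩ g)
  invariant : ∀ γ ∈ Γ, ∀ f ∈ F, γ '' f ∈ F
  /-- the surface has only finitely many triangles -/
  finite_mod : ∃ F₀ : Set (Set Mink), F₀.Finite ∧ F₀ ⊆ F ∧
    ∀ f ∈ F, ∃ g ∈ F₀, ∃ γ ∈ Γ, f = γ '' g

/-- The vertices of the lifted triangulation. -/
def vertices (F : Set (Set Mink)) : Set Mink := ⋃₀ F

/-- `ijk` and `ijl` are the two different triangles at the edge `ij`. -/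
def AdjacentTriangles (F : Set (Set Mink)) (i j k l : Mink) : Prop :=
  ({i, j, k} : Set Mink) ∈ F ∧ ({i, j, l} : Set Mink) ∈ F ∧ k ≠ l

/-- The point `x` lies strictly inside the circumcycle (circle, horocycle or hypercycle) of the
triangle `abc`. The circumcycle is the section of the hyperboloid by the affine plane
`⟨o, ·⟩ = -1` through `a`, `b`, `c`, and its inside is the side which contains the triangle, that
is, the origin's side of the plane. If `o` is timelike, then `o = (cosh r)⁻¹ • p` with `p` the centre
and `r` the radius of the circumcircle, and the condition says that `x` is at distance less than
`r` from `p`. -/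
def InsideCircumcycle (a b c x : Mink) : Prop :=
  ∃ o : Mink, mink o a = -1 ∧ mink o b = -1 ∧ mink o c = -1 ∧ -1 < mink o x

/-- The (local) Delaunay condition at every edge: the opposite vertex of the neighbouring triangle
does not lie inside the circumcycle. Four concyclic vertices are allowed. -/
def IsDelaunay (F : Set (Set Mink)) : Prop :=
  ∀ i j k l, AdjacentTriangles F i j k l → ¬ InsideCircumcycle i j k l

/-- Stereographic projection from `(-1, 0, 0)` of the hyperboloid to the Poincaré disk. -/
noncomputable def toDisk (x : Mink) : ℂ := ⟨x 1 / (1 + x 0), x 2 / (1 + x 0)⟩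

/-- The complex cross-ratio. -/
noncomputable def crossRatio (z₁ z₂ z₃ z₄ : ℂ) : ℂ :=
  ((z₁ - z₃) * (z₂ - z₄)) / ((z₁ - z₄) * (z₂ - z₃))

/-- The signed intersection angle of the circumcycles of the triangles `ijk` and `ijl`:
the argument of the complex number `X_{ij} = - cr (z_i, z_j, z_k, z_l)`, where `z` is the image in
the (conformal) Poincaré disk. It is `0` if the two circumcycles coincide. Exchanging `k` and `l`,
or reversing the orientation of the plane, changes its sign. -/
noncomputable def intersectionAngle (i j k l : Mink) : ℝ :=
  Complex.arg (-crossRatio (toDisk i) (toDisk j) (toDisk k) (toDisk l))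

/-- `p` is a smooth motion, inside the hyperbolic plane and for small times, of the vertices,
with initial velocities `η`. -/
def IsMotion (F : Set (Set Mink)) (η : Mink → Mink) (p : Mink → ℝ → Mink) : Prop :=
  ∀ v ∈ vertices F, p v 0 = v ∧ (∀ᶠ t in nhds (0 : ℝ), p v t ∈ hypPlane) ∧
    ContDiffAt ℝ ((⊤ : ℕ∞) : WithTop ℕ∞) (p v) 0 ∧ HasDerivAt (p v) (η v) 0

/-- Moving the vertices with the initial velocities `η` keeps the intersection angles of the
circumcycles of all pairs of adjacent triangles constant to first order. -/
def PreservesIntersectionAngles (F : Set (Set Mink)) (η : Mink → Mink) : Prop :=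
  ∀ p : Mink → ℝ → Mink, IsMotion F η p → ∀ i j k l, AdjacentTriangles F i j k l →
    HasDerivAt (fun t => intersectionAngle (p i t) (p j t) (p k t) (p l t)) 0 0

/-- `A` is an infinitesimal isometry of the hyperbolic plane (an element of `so(2,1)`),
with the Killing field `x ↦ A x`. -/
def IsInfinitesimalIsometry (A : Mink →ₗ[ℝ] Mink) : Prop :=
  ∀ x y, mink (A x) y + mink x (A y) = 0

/-- The field `η` is tangent to the hyperbolic plane at the vertices. -/
def IsTangentField (F : Set (Set Mink)) (η : Mink → Mink) : Prop :=
  ∀ v ∈ vertices F, mink (η v) v = 0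

/-- The infinitesimal deformation `η` preserves the hyperbolic structure of `ℍ² / Γ`,
up to the infinitesimal isometry `A` of the universal cover: after subtracting
the Killing field of `A`, it is `Γ`-equivariant, that is, it descends to the vertices of the
fixed surface. Equivalently, to first order the holonomy of `γ` moves only by conjugation,
`γ ↦ exp (t A) γ exp (-t A)`. For `A = 0` the vertices move on the fixed surface. -/
def PreservesHyperbolicStructure (Γ : Subgroup (Mink ≃ₗ[ℝ] Mink)) (F : Set (Set Mink))
    (A : Mink →ₗ[ℝ] Mink) (η : Mink → Mink) : Prop :=
  ∀ γ ∈ Γ, ∀ v ∈ vertices F, η (γ v) - A (γ v) = γ (η v - A v)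

end CirclePattern

namespace CirclePattern

/-! The proof turns the deformation into a discrete flow on the triangulated surface. For a fixed
vector `τ` the field `x ↦ τ + ⟨τ,x⟩ x` is tangent to the hyperboloid and conformal, and it changes
the logarithm of the squared chord between `i` and `j` at the rate `⟨τ,i⟩ + ⟨τ,j⟩`. On each triangle
the three chord rates of `η` therefore single out one vector `τ` (`triangleShift`), and `η` agrees
at the three vertices with the conformal field of `τ` up to a Killing field.

Through the edge `ij` put the flux `det3 i j τ`. The argument of `cornerNumber i j k` changes at the
rate flux divided by `1 - ⟨i,j⟩` (`cornerNumber_rate`), a denominator that only the edge sees. So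
preserving the intersection angle means that the fluxes computed from the two sides of an edge
agree.

Let `o` be the pole of a triangle and `U = ⟨o,τ⟩`. The total flux of a triangle is `-det3 i j k * U`
(`flux_sum`), and the jump of `U` across an edge is the flux times a factor whose sign is fixed by
the Delaunay condition (`radialRate_sub`). Summation by parts over the finitely many triangles
modulo `Γ` equates a nonnegative edge sum with a nonpositive multiple of the sum of `|det3| * U ^
2`, hence `U = 0` (`potential_eq_zero`).

Flux could still cross edges between concyclic triangles. On a shortest edge carrying flux, one of
the two opposite angles of the inscribed quadrilateral is not acute; in that triangle the other two
edges are shorter and carry none, and the zero total kills the flux (`flux_eq_zero`). With all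
fluxes zero, `τ = 0` and every triangle moves by an infinitesimal isometry. Neighbours share two
vertices, so it is the same Killing field everywhere; after subtracting `A` it commutes with `Γ`,
has bounded length by cocompactness, and vanishes. -/

/-! ### Linear algebra of Minkowski space -/

/-- The determinant of three vectors. -/
def det3 (x y z : Mink) : ℝ :=
  x 0 * (y 1 * z 2 - y 2 * z 1) - x 1 * (y 0 * z 2 - y 2 * z 0) + x 2 * (y 0 * z 1 - y 1 * z 0)

/-- The Minkowski cross product, `mink (cross x y) z = det3 x y z`. -/
def cross (x y : Mink) : Mink :=
  ![-(x 1 * y 2 - x 2 * y 1), x 2 * y 0 - x 0 * y 2, x 0 * y 1 - x 1 * y 0]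

theorem mink_cross (x y z : Mink) : mink (cross x y) z = det3 x y z := by
  simp [mink, cross, det3]; ring

theorem mink_comm (x y : Mink) : mink x y = mink y x := by simp only [mink]; ring

theorem mink_add_left (x y z : Mink) : mink (x + y) z = mink x z + mink y z := by
  simp only [mink, Pi.add_apply]; ring

theorem mink_add_right (x y z : Mink) : mink z (x + y) = mink z x + mink z y := by
  simp only [mink, Pi.add_apply]; ring

theorem mink_sub_left (x y z : Mink) : mink (x - y) z = mink x z - mink y z := by
  simp only [mink, Pi.sub_apply]; ring

theorem mink_sub_right (x y z : Mink) : mink z (x - y) = mink z x - mink z y := by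
  simp only [mink, Pi.sub_apply]; ring

theorem mink_smul_left (a : ℝ) (x y : Mink) : mink (a • x) y = a * mink x y := by
  simp only [mink, Pi.smul_apply, smul_eq_mul]; ring

theorem mink_smul_right (a : ℝ) (x y : Mink) : mink x (a • y) = a * mink x y := by
  simp only [mink, Pi.smul_apply, smul_eq_mul]; ring

theorem mink_zero_left (x : Mink) : mink 0 x = 0 := by simp [mink]

theorem det3_rotate (x y z : Mink) : det3 y z x = det3 x y z := by simp only [det3]; ring

/-- The product of two determinants is minus the determinant of the Gram matrix. -/
theorem det3_mul_det3 (x y z x' y' z' : Mink) :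
    det3 x y z * det3 x' y' z' =
      -(mink x x' * (mink y y' * mink z z' - mink y z' * mink z y')
        - mink x y' * (mink y x' * mink z z' - mink y z' * mink z x')
        + mink x z' * (mink y x' * mink z y' - mink y y' * mink z x')) := by
  simp only [det3, mink]; ring

/-- Cramer's rule with the denominator cleared, hence valid also for dependent vectors. -/
theorem det3_smul_eq (x y z w : Mink) :
    det3 x y z • w = det3 w y z • x + det3 x w z • y + det3 x y w • z := by
  ext n
  fin_cases n <;> simp [det3] <;> ring

/-- Two vectors with the same products with a basis are equal. -/
theorem eq_of_mink_eq {i j k a b : Mink} (h : det3 i j k ≠ 0) (hi : mink a i = mink b i)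
    (hj : mink a j = mink b j) (hk : mink a k = mink b k) : a = b := by
  have key : ∀ c : Mink, mink a c = mink b c := by
    intro c
    have h1 := congrArg (mink a) (det3_smul_eq i j k c)
    have h2 := congrArg (mink b) (det3_smul_eq i j k c)
    simp only [mink_add_right, mink_smul_right] at h1 h2
    rw [hi, hj, hk, ← h2] at h1
    exact mul_left_cancel₀ h h1
  have h0 := key ![1, 0, 0]
  have h1 := key ![0, 1, 0]
  have h2 := key ![0, 0, 1]
  simp [mink] at h0 h1 h2
  ext n
  fin_cases n
  · exact h0
  · exact h1
  · exact h2

/-- The vector with prescribed products with the basis `i`, `j`, `k`. -/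
noncomputable def dualVec (i j k : Mink) (a b c : ℝ) : Mink :=
  (det3 i j k)⁻¹ • (a • cross j k + b • cross k i + c • cross i j)

theorem mink_dualVec {i j k : Mink} (h : det3 i j k ≠ 0) (a b c : ℝ) :
    mink (dualVec i j k a b c) i = a ∧ mink (dualVec i j k a b c) j = b ∧
      mink (dualVec i j k a b c) k = c := by
  have e1 : ∀ x y : Mink, det3 x y x = 0 := fun x y => by simp only [det3]; ring
  have e2 : ∀ x y : Mink, det3 x y y = 0 := fun x y => by simp only [det3]; ring
  have r1 : det3 j k i = det3 i j k := by simp only [det3]; ring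
  have r2 : det3 k i j = det3 i j k := by simp only [det3]; ring
  simp only [dualVec, mink_smul_left, mink_add_left, mink_cross, e1, e2, r1, r2]
  refine ⟨?_, ?_, ?_⟩ <;> field_simp <;> ring

/-! ### The hyperbolic plane -/

theorem mink_lt_neg_one {x y : Mink} (hx : x ∈ hypPlane) (hy : y ∈ hypPlane) (h : x ≠ y) :
    mink x y < -1 := by
  obtain ⟨hx1, hx0⟩ := hx
  obtain ⟨hy1, hy0⟩ := hy
  simp only [mink] at *
  have hp : 0 < x 0 * y 0 := mul_pos hx0 hy0
  by_contra hc
  push Not at hc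
  have hge : x 0 * y 0 ≤ x 1 * y 1 + x 2 * y 2 + 1 := by linarith
  -- Reversed Cauchy–Schwarz with its remainder as a sum of squares, which must vanish if the
  -- inequality fails.
  have hid : (x 0 * y 0) ^ 2 = (x 1 * y 1 + x 2 * y 2 + 1) ^ 2 + (x 1 - y 1) ^ 2
      + (x 2 - y 2) ^ 2 + (x 1 * y 2 - x 2 * y 1) ^ 2 := by
    have e1 : x 0 * x 0 = 1 + x 1 * x 1 + x 2 * x 2 := by linarith
    have e2 : y 0 * y 0 = 1 + y 1 * y 1 + y 2 * y 2 := by linarith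
    calc (x 0 * y 0) ^ 2 = (x 0 * x 0) * (y 0 * y 0) := by ring
      _ = _ := by rw [e1, e2]; ring
  have hsq : (x 0 * y 0) ^ 2 ≤ (x 1 * y 1 + x 2 * y 2 + 1) ^ 2 :=
    pow_le_pow_left₀ hp.le hge 2
  have h1 : x 1 - y 1 = 0 := by
    have : (x 1 - y 1) ^ 2 ≤ 0 := by nlinarith [sq_nonneg (x 2 - y 2), sq_nonneg (x 1 * y 2 - x 2 * y 1)]
    exact pow_eq_zero_iff two_ne_zero |>.1 (le_antisymm this (sq_nonneg _))
  have h2 : x 2 - y 2 = 0 := by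
    have : (x 2 - y 2) ^ 2 ≤ 0 := by nlinarith [sq_nonneg (x 1 - y 1), sq_nonneg (x 1 * y 2 - x 2 * y 1)]
    exact pow_eq_zero_iff two_ne_zero |>.1 (le_antisymm this (sq_nonneg _))
  apply h
  have h1' : x 1 = y 1 := by linarith
  have h2' : x 2 = y 2 := by linarith
  have h0' : x 0 = y 0 := by
    have : (x 0 - y 0) * (x 0 + y 0) = 0 := by
      rw [h1', h2'] at hx1; linarith
    rcases mul_eq_zero.1 this with h | h <;> linarith
  ext n
  fin_cases n
  · exact h0'
  · exact h1'
  · exact h2'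

theorem mink_le_neg_one {x y : Mink} (hx : x ∈ hypPlane) (hy : y ∈ hypPlane) :
    mink x y ≤ -1 := by
  by_cases h : x = y
  · subst h; exact hx.1.le
  · exact (mink_lt_neg_one hx hy h).le

theorem ne_of_det3_ne_zero {i j k : Mink} (h : det3 i j k ≠ 0) : i ≠ j ∧ i ≠ k ∧ j ≠ k := by
  refine ⟨?_, ?_, ?_⟩ <;> rintro rfl <;> apply h <;> simp only [det3] <;> ring

/-! ### The infinitesimal change of the shape of a triangle -/

/-- Twice the logarithmic rate of change of the chord length between `i` and `j`. -/
noncomputable def chordRate (η : Mink → Mink) (i j : Mink) : ℝ :=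
  (mink (η i) j + mink i (η j)) / (1 + mink i j)

/-- The translational part of the infinitesimal Möbius transformation which moves the vertices
of the triangle `ijk` with the velocities `η`. -/
noncomputable def triangleShift (η : Mink → Mink) (i j k : Mink) : Mink :=
  dualVec i j k ((chordRate η i j + chordRate η i k - chordRate η j k) / 2)
    ((chordRate η j i + chordRate η j k - chordRate η i k) / 2)
    ((chordRate η k i + chordRate η k j - chordRate η i j) / 2)

/-- The pole of the plane through `i`, `j`, `k`. -/
noncomputable def pole (i j k : Mink) : Mink := dualVec i j k (-1) (-1) (-1)

theorem chordRate_comm (η : Mink → Mink) (i j : Mink) : chordRate η i j = chordRate η j i := by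
  simp only [chordRate, mink_comm i j, mink_comm (η i) j, mink_comm i (η j)]
  rw [add_comm (mink j (η i))]

/-- The defining property of the shift: the conformal field `x ↦ τ + ⟨τ,x⟩ x` has the same three
chord rates as `η`. -/
theorem mink_triangleShift {η : Mink → Mink} {i j k : Mink} (h : det3 i j k ≠ 0) :
    mink (triangleShift η i j k) i + mink (triangleShift η i j k) j = chordRate η i j ∧
    mink (triangleShift η i j k) i + mink (triangleShift η i j k) k = chordRate η i k ∧
    mink (triangleShift η i j k) j + mink (triangleShift η i j k) k = chordRate η j k := by
  obtain ⟨h1, h2, h3⟩ := mink_dualVec h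
    ((chordRate η i j + chordRate η i k - chordRate η j k) / 2)
    ((chordRate η j i + chordRate η j k - chordRate η i k) / 2)
    ((chordRate η k i + chordRate η k j - chordRate η i j) / 2)
  have c1 := chordRate_comm η j i
  have c2 := chordRate_comm η k i
  have c3 := chordRate_comm η k j
  rw [triangleShift, h1, h2, h3]
  refine ⟨?_, ?_, ?_⟩ <;> linarith

theorem eq_triangleShift {η : Mink → Mink} {i j k w : Mink} (h : det3 i j k ≠ 0)
    (hij : mink w i + mink w j = chordRate η i j) (hik : mink w i + mink w k = chordRate η i k)
    (hjk : mink w j + mink w k = chordRate η j k) : w = triangleShift η i j k := by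
  obtain ⟨h1, h2, h3⟩ := mink_triangleShift (η := η) h
  apply eq_of_mink_eq h <;> linarith

theorem triangleShift_rotate {η : Mink → Mink} {i j k : Mink} (h : det3 i j k ≠ 0) :
    triangleShift η j k i = triangleShift η i j k := by
  obtain ⟨h1, h2, h3⟩ := mink_triangleShift (η := η) (i := j) (j := k) (k := i)
    (by rwa [det3_rotate])
  apply eq_triangleShift h
  · rw [chordRate_comm η i j]; linarith
  · rw [chordRate_comm η i k]; linarith
  · linarith

theorem mink_pole {i j k : Mink} (h : det3 i j k ≠ 0) :
    mink (pole i j k) i = -1 ∧ mink (pole i j k) j = -1 ∧ mink (pole i j k) k = -1 :=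
  mink_dualVec h _ _ _

theorem eq_pole {i j k w : Mink} (h : det3 i j k ≠ 0) (hi : mink w i = -1) (hj : mink w j = -1)
    (hk : mink w k = -1) : w = pole i j k := by
  obtain ⟨h1, h2, h3⟩ := mink_pole h
  exact eq_of_mink_eq h (hi.trans h1.symm) (hj.trans h2.symm) (hk.trans h3.symm)

theorem pole_rotate {i j k : Mink} (h : det3 i j k ≠ 0) : pole j k i = pole i j k := by
  obtain ⟨h1, h2, h3⟩ := mink_pole (i := j) (j := k) (k := i) (by rwa [det3_rotate])
  exact eq_pole h h3 h1 h2

/-- The flux through the edge `ij` of the triangle `ijk`. -/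
noncomputable def flux (η : Mink → Mink) (i j k : Mink) : ℝ := det3 i j (triangleShift η i j k)

/-- The rate of change of the circumradius of `ijk`, suitably normalized. -/
noncomputable def radialRate (η : Mink → Mink) (i j k : Mink) : ℝ :=
  mink (pole i j k) (triangleShift η i j k)

theorem radialRate_rotate {η : Mink → Mink} {i j k : Mink} (h : det3 i j k ≠ 0) :
    radialRate η j k i = radialRate η i j k := by
  rw [radialRate, radialRate, pole_rotate h, triangleShift_rotate h]

/-- The total flux out of a triangle. -/
theorem flux_sum {η : Mink → Mink} {i j k : Mink} (h : det3 i j k ≠ 0) :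
    flux η i j k + flux η j k i + flux η k i j = -det3 i j k * radialRate η i j k := by
  have h' : det3 j k i ≠ 0 := by rwa [det3_rotate]
  simp only [flux, radialRate]
  rw [triangleShift_rotate h', triangleShift_rotate h]
  simp only [pole, dualVec, mink_smul_left, mink_add_left, mink_cross]
  field_simp
  ring

/-- Up to the factor `det3 i j k`, the three fluxes are the coordinates of the shift in the basis
`i`, `j`, `k`. -/
theorem triangleShift_eq_zero {η : Mink → Mink} {i j k : Mink} (h : det3 i j k ≠ 0)
    (h1 : flux η i j k = 0) (h2 : flux η j k i = 0) (h3 : flux η k i j = 0) :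
    triangleShift η i j k = 0 := by
  have h' : det3 j k i ≠ 0 := by rwa [det3_rotate]
  simp only [flux] at h1 h2 h3
  rw [triangleShift_rotate h'] at h3
  rw [triangleShift_rotate h] at h2 h3
  have := det3_smul_eq i j k (triangleShift η i j k)
  rw [h1, ← det3_rotate i (triangleShift η i j k) k, ← det3_rotate (triangleShift η i j k) k i,
    h3, ← det3_rotate (triangleShift η i j k) j k, h2] at this
  simpa [h] using this

/-- Across an edge, the radial rates differ by a multiple of the flux. -/
theorem radialRate_sub {η : Mink → Mink} {i j k l : Mink} (hi : i ∈ hypPlane) (hj : j ∈ hypPlane)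
    (hk : det3 i j k ≠ 0) (hl : det3 i j l ≠ 0) (hs : flux η i j k = flux η i j l) :
    (radialRate η i j k - radialRate η i j l) * det3 i j l
      = (mink (pole i j k) l + 1) * flux η i j k := by
  obtain ⟨p1, p2, -⟩ := mink_pole hk
  obtain ⟨q1, q2, q3⟩ := mink_pole hl
  obtain ⟨t1, -, -⟩ := mink_triangleShift (η := η) hk
  obtain ⟨t2, -, -⟩ := mink_triangleShift (η := η) hl
  have hij := mink_lt_neg_one hi hj (ne_of_det3_ne_zero hk).1
  have hii := hi.1
  have hjj := hj.1
  simp only [radialRate, flux] at *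
  generalize triangleShift η i j k = τ at *
  generalize triangleShift η i j l = σ at *
  generalize pole i j k = o at *
  generalize pole i j l = o' at *
  have e1 := det3_smul_eq i j l (τ - σ)
  have hz : det3 i j (τ - σ) = 0 := by
    have : det3 i j (τ - σ) = det3 i j τ - det3 i j σ := by
      simp only [det3, Pi.sub_apply]; ring
    rw [this, hs, sub_self]
  rw [hz, zero_smul, add_zero] at e1
  have e2 := congrArg (fun w => mink w (i + j)) e1
  simp only [mink_smul_left, mink_add_left, mink_sub_left, mink_add_right, mink_comm j i,
    hii, hjj] at e2
  -- Equal fluxes put `τ - σ` in the span of `i` and `j`; the common chord rate of `ij` makes the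
  -- two coordinates opposite. So `τ - σ` is a multiple of `i - j`, which both poles annihilate.
  have hab : det3 (τ - σ) j l + det3 i (τ - σ) l = 0 := by
    have : (det3 (τ - σ) j l + det3 i (τ - σ) l) * (mink i j - 1) = 0 := by
      linear_combination -e2 + det3 i j l * (t1 - t2)
    rcases mul_eq_zero.1 this with h | h
    · exact h
    · linarith
  have e3 := congrArg (mink o) e1
  simp only [mink_smul_right, mink_add_right, mink_sub_right, p1, p2] at e3
  -- `o - o'` is orthogonal to `i` and `j`, so only the `l`-coordinate of `σ`, which is the flux,
  -- survives.
  have e5 := congrArg (mink (o - o')) (det3_smul_eq i j l σ)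
  simp only [mink_smul_right, mink_add_right, mink_sub_left, p1, p2, q1, q2, q3] at e5
  rw [hs]
  linear_combination e3 - hab + e5

/-- In an inscribed quadrilateral, one of two opposite angles is not acute. -/
theorem exists_not_acute {i j k l o : Mink} (hi : i ∈ hypPlane) (hj : j ∈ hypPlane)
    (hk : k ∈ hypPlane) (hl : l ∈ hypPlane) (oi : mink o i = -1) (oj : mink o j = -1)
    (ok : mink o k = -1) (ol : mink o l = -1) (h : det3 i j k * det3 i j l < 0) :
    mink (i - k) (j - k) ≤ 0 ∨ mink (i - l) (j - l) ≤ 0 := by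
  have hL : ∀ x ∈ hypPlane, mink (i - x) (j - x) = -1 + mink i j - mink i x - mink j x := by
    intro x hx
    simp only [mink_sub_left, mink_sub_right, mink_comm x, hx.1]
    have := hx.1
    rw [mink_comm] at this
    linarith
  rw [hL k hk, hL l hl]
  by_contra hc
  push Not at hc
  obtain ⟨c1, c2⟩ := hc
  have hk0 : det3 i j k ≠ 0 := by rintro h0; simp [h0] at h
  have e := det3_smul_eq i j k l
  have eo := congrArg (mink o) e
  have ei := congrArg (mink i) e
  have ej := congrArg (mink j) e
  simp only [mink_smul_right, mink_add_right, oi, oj, ok, ol, hi.1, hj.1, mink_comm j i]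
    at eo ei ej
  -- On the plane of the quadrilateral, `x ↦ -1 + ⟨i,j⟩ - ⟨i,x⟩ - ⟨j,x⟩` is affine and vanishes at
  -- `i` and `j`. Its values at `k` and `l` are therefore in the ratio of the determinants, and so
  -- of opposite sign.
  have key : det3 i j k * (-1 + mink i j - mink i l - mink j l)
      = det3 i j l * (-1 + mink i j - mink i k - mink j k) := by
    linear_combination -ei - ej - (-1 + mink i j) * eo
  have : det3 i j k * det3 i j k * (-1 + mink i j - mink i l - mink j l)
      = det3 i j k * det3 i j l * (-1 + mink i j - mink i k - mink j k) := by
    linear_combination det3 i j k * key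
  have h1 : 0 < det3 i j k * det3 i j k * (-1 + mink i j - mink i l - mink j l) :=
    mul_pos (mul_self_pos.2 hk0) c2
  have h2 : det3 i j k * det3 i j l * (-1 + mink i j - mink i k - mink j k) < 0 :=
    mul_neg_of_neg_of_pos h c1
  linarith

/-- The side opposite to an angle which is not acute is the longest one. -/
theorem mink_lt_of_not_acute {i j k : Mink} (hi : i ∈ hypPlane) (hj : j ∈ hypPlane)
    (hk : k ∈ hypPlane) (hik : i ≠ k) (hjk : j ≠ k) (h : mink (i - k) (j - k) ≤ 0) :
    mink i j < mink j k ∧ mink i j < mink k i := by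
  have h1 := mink_lt_neg_one hi hk hik
  have h2 := mink_lt_neg_one hj hk hjk
  have h3 := hk.1
  simp only [mink_sub_left, mink_sub_right, mink_comm k j] at h
  rw [mink_comm k i]
  constructor <;> linarith

/-! ### Isometries -/

theorem det3_mul_det3_map {γ : Mink ≃ₗ[ℝ] Mink}
    (hγ : ∀ x y, mink (γ x) (γ y) = mink x y) (x y z x' y' z' : Mink) :
    det3 (γ x) (γ y) (γ z) * det3 (γ x') (γ y') (γ z') = det3 x y z * det3 x' y' z' := by
  simp only [det3_mul_det3, hγ]

theorem det3_map_ne_zero {γ : Mink ≃ₗ[ℝ] Mink}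
    (hγ : ∀ x y, mink (γ x) (γ y) = mink x y) {i j k : Mink}
    (h : det3 i j k ≠ 0) : det3 (γ i) (γ j) (γ k) ≠ 0 := by
  intro h0
  have := det3_mul_det3_map hγ i j k i j k
  rw [h0, mul_zero] at this
  exact h (mul_self_eq_zero.1 this.symm)

theorem pole_map {γ : Mink ≃ₗ[ℝ] Mink}
    (hγ : ∀ x y, mink (γ x) (γ y) = mink x y) {i j k : Mink}
    (h : det3 i j k ≠ 0) : pole (γ i) (γ j) (γ k) = γ (pole i j k) := by
  obtain ⟨h1, h2, h3⟩ := mink_pole h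
  symm
  apply eq_pole (det3_map_ne_zero hγ h) <;> rwa [hγ]

theorem triangleShift_map {γ : Mink ≃ₗ[ℝ] Mink}
    (hγ : ∀ x y, mink (γ x) (γ y) = mink x y) {η : Mink → Mink}
    {i j k : Mink} (h : det3 i j k ≠ 0) (hij : chordRate η (γ i) (γ j) = chordRate η i j)
    (hik : chordRate η (γ i) (γ k) = chordRate η i k)
    (hjk : chordRate η (γ j) (γ k) = chordRate η j k) :
    triangleShift η (γ i) (γ j) (γ k) = γ (triangleShift η i j k) := by
  obtain ⟨h1, h2, h3⟩ := mink_triangleShift (η := η) h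
  symm
  apply eq_triangleShift (det3_map_ne_zero hγ h) <;> simp only [hγ] <;> linarith

/-! ### Intersection angles and their first variation -/

/-- A complex number whose argument is, up to a term which depends only on `i` and `j`, the angle
between the circumcycle of `ijk` and the edge `ij`. -/
def cornerNumber (i j k : Mink) : ℂ := ⟨mink (i - k) (j - k), -det3 i j k⟩

theorem exists_disk_coordinates {x : Mink} (hx : x ∈ hypPlane) :
    ∃ a b : ℝ, 0 < 1 - a ^ 2 - b ^ 2 ∧ toDisk x = ⟨a, b⟩ ∧
      x 0 = (1 + a ^ 2 + b ^ 2) / (1 - a ^ 2 - b ^ 2) ∧ x 1 = 2 * a / (1 - a ^ 2 - b ^ 2) ∧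
      x 2 = 2 * b / (1 - a ^ 2 - b ^ 2) := by
  obtain ⟨h1, h0⟩ := hx
  simp only [mink] at h1
  have hS : 0 < 1 + x 0 := by linarith
  have hq : 1 - (x 1 / (1 + x 0)) ^ 2 - (x 2 / (1 + x 0)) ^ 2 = 2 / (1 + x 0) := by
    field_simp
    linear_combination -h1
  refine ⟨x 1 / (1 + x 0), x 2 / (1 + x 0), ?_, rfl, ?_, ?_, ?_⟩
  · rw [hq]; positivity
  · have : 1 + (x 1 / (1 + x 0)) ^ 2 + (x 2 / (1 + x 0)) ^ 2 = 2 - 2 / (1 + x 0) := by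
      linarith
    rw [hq, this]; field_simp; ring
  · rw [hq]; field_simp
  · rw [hq]; field_simp

theorem cornerNumber_eq {i j k : Mink} (hi : i ∈ hypPlane) (hj : j ∈ hypPlane)
    (hk : k ∈ hypPlane) : ∃ r : ℝ, 0 < r ∧ cornerNumber i j k =
      r * ((toDisk i - toDisk k) * (1 - starRingEnd ℂ (toDisk i) * toDisk j)
        * starRingEnd ℂ (toDisk j - toDisk k)) := by
  obtain ⟨a, b, p, hz, h0, h1, h2⟩ := exists_disk_coordinates hi
  obtain ⟨a', b', p', hz', h0', h1', h2'⟩ := exists_disk_coordinates hj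
  obtain ⟨a'', b'', p'', hz'', h0'', h1'', h2''⟩ := exists_disk_coordinates hk
  refine ⟨4 / ((1 - a ^ 2 - b ^ 2) * (1 - a' ^ 2 - b' ^ 2) * (1 - a'' ^ 2 - b'' ^ 2)),
    by positivity, ?_⟩
  rw [hz, hz', hz'']
  have hL : mink (i - k) (j - k) = mink i j - mink i k - mink j k - 1 := by
    have := hk.1
    simp only [mink_sub_left, mink_sub_right, mink_comm k j]
    linarith
  apply Complex.ext
  · rw [Complex.re_ofReal_mul]
    change mink (i - k) (j - k) = _
    rw [hL]
    simp only [mink, h0, h1, h2, h0', h1', h2', h0'', h1'', h2'', Complex.mul_re, Complex.mul_im,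
      Complex.sub_re, Complex.sub_im, Complex.conj_re, Complex.conj_im, Complex.one_re,
      Complex.one_im]
    field_simp
    ring
  · rw [Complex.im_ofReal_mul]
    change -det3 i j k = _
    simp only [det3, h0, h1, h2, h0', h1', h2', h0'', h1'', h2'', Complex.mul_re, Complex.mul_im,
      Complex.sub_re, Complex.sub_im, Complex.conj_re, Complex.conj_im, Complex.one_re,
      Complex.one_im]
    field_simp
    ring

/-- By `cornerNumber_eq`, the factor belonging to the edge `ij` enters the product only through its
squared modulus. -/
theorem cornerNumber_mul_conj {i j k l : Mink} (hi : i ∈ hypPlane) (hj : j ∈ hypPlane)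
    (hk : k ∈ hypPlane) (hl : l ∈ hypPlane) : ∃ r : ℝ, 0 ≤ r ∧
      cornerNumber i j k * starRingEnd ℂ (cornerNumber i j l) =
        r * crossRatio (toDisk i) (toDisk j) (toDisk k) (toDisk l) := by
  obtain ⟨r, hr, h⟩ := cornerNumber_eq hi hj hk
  obtain ⟨r', hr', h'⟩ := cornerNumber_eq hi hj hl
  refine ⟨r * r' * Complex.normSq (1 - starRingEnd ℂ (toDisk i) * toDisk j)
    * Complex.normSq ((toDisk i - toDisk l) * (toDisk j - toDisk k)),
    mul_nonneg (mul_nonneg (by positivity) (Complex.normSq_nonneg _)) (Complex.normSq_nonneg _), ?_⟩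
  rw [h, h', crossRatio]
  push_cast
  rw [Complex.normSq_eq_conj_mul_self, Complex.normSq_eq_conj_mul_self]
  generalize 1 - starRingEnd ℂ (toDisk i) * toDisk j = w
  generalize toDisk i - toDisk k = p
  generalize toDisk j - toDisk l = q
  generalize toDisk i - toDisk l = p'
  generalize toDisk j - toDisk k = q'
  simp only [map_mul, Complex.conj_conj, Complex.conj_ofReal]
  -- If the cross-ratio has denominator zero its value is `0` by convention, and the left side
  -- vanishes as well.
  by_cases h0 : p' * q' = 0
  · have : starRingEnd ℂ p' * starRingEnd ℂ q' = 0 := by rw [← map_mul, h0, map_zero]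
    rw [h0, div_zero, mul_zero]
    linear_combination r * r' * p * w * starRingEnd ℂ w * q * this
  · have := mul_div_cancel₀ (p * q) h0
    linear_combination -(r * r' * w * starRingEnd ℂ w * starRingEnd ℂ p' * starRingEnd ℂ q') * this

theorem intersectionAngle_eq {i j k l : Mink} (hi : i ∈ hypPlane) (hj : j ∈ hypPlane)
    (hk : k ∈ hypPlane) (hl : l ∈ hypPlane)
    (h : cornerNumber i j k * starRingEnd ℂ (cornerNumber i j l) ≠ 0) :
    intersectionAngle i j k l
      = Complex.arg (-(cornerNumber i j k * starRingEnd ℂ (cornerNumber i j l))) := by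
  obtain ⟨r, hr, e⟩ := cornerNumber_mul_conj hi hj hk hl
  have hr' : 0 < r := by
    rcases hr.eq_or_lt with rfl | h'
    · simp [e] at h
    · exact h'
  rw [e, intersectionAngle, ← mul_neg, Complex.arg_real_mul _ hr']

/-- Since `f * exp (-i arg f) = ‖f‖` is real at all times, the imaginary part of its derivative is
zero, and the exponential contributes nothing when `arg f` is stationary. The branch cut of `arg`
needs no separate treatment. -/
theorem im_mul_conj_eq_zero_of_arg {f : ℝ → ℂ} {f' : ℂ} {t : ℝ} (hf : HasDerivAt f f' t)
    (h : HasDerivAt (fun s => Complex.arg (f s)) 0 t) : (f' * starRingEnd ℂ (f t)).im = 0 := by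
  have h1 : HasDerivAt (fun s => Complex.exp (-((Complex.arg (f s) : ℂ) * Complex.I))) 0 t := by
    have := ((h.ofReal_comp.mul_const Complex.I).neg).cexp
    simpa using this
  have h2 := hf.mul h1
  have hreal : ∀ s, f s * Complex.exp (-((Complex.arg (f s) : ℂ) * Complex.I)) = (‖f s‖ : ℂ) := by
    intro s
    nth_rw 1 [← Complex.norm_mul_exp_arg_mul_I (f s)]
    rw [mul_assoc, ← Complex.exp_add]
    simp
  have h3 := Complex.imCLM.hasFDerivAt.comp_hasDerivAt t h2
  have h4 : HasDerivAt (fun _ : ℝ => (0 : ℝ)) 0 t := hasDerivAt_const t 0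
  have h5 : (⇑Complex.imCLM ∘ (f * fun s => Complex.exp (-((Complex.arg (f s) : ℂ) * Complex.I))))
      = fun _ : ℝ => (0 : ℝ) := by
    ext s
    simp [hreal s, -Complex.ofReal_neg]
  rw [h5] at h3
  have h6 := h3.unique h4
  have hc : starRingEnd ℂ (f t)
      = ‖f t‖ * Complex.exp (-((Complex.arg (f t) : ℂ) * Complex.I)) := by
    nth_rw 1 [← Complex.norm_mul_exp_arg_mul_I (f t)]
    rw [map_mul, ← Complex.exp_conj]
    simp
  rw [hc, mul_left_comm, Complex.im_ofReal_mul]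
  simp only [mul_zero, add_zero, Complex.imCLM_apply] at h6
  rw [h6, mul_zero]

theorem normSq_cornerNumber {i j k : Mink} (hi : i ∈ hypPlane) (hj : j ∈ hypPlane)
    (hk : k ∈ hypPlane) : Complex.normSq (cornerNumber i j k)
      = 2 * (1 + mink i k) * (1 + mink j k) * (1 - mink i j) := by
  have e := det3_mul_det3 i j k i j k
  rw [hi.1, hj.1, hk.1, mink_comm j i, mink_comm k i, mink_comm k j] at e
  have hk1 := hk.1
  rw [cornerNumber, Complex.normSq_mk]
  simp only [mink_sub_left, mink_sub_right, mink_comm k j, hk1]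
  linear_combination e

/-- The rate of change of the argument of `cornerNumber`. -/
theorem cornerNumber_rate {η : Mink → Mink} {i j k : Mink} (hi : i ∈ hypPlane)
    (hj : j ∈ hypPlane) (hk : k ∈ hypPlane) (ti : mink (η i) i = 0) (tj : mink (η j) j = 0)
    (tk : mink (η k) k = 0) (h : det3 i j k ≠ 0) :
    ((mink (η i - η k) (j - k) + mink (i - k) (η j - η k)) * det3 i j k
      - mink (i - k) (j - k) * (det3 (η i) j k + det3 i (η j) k + det3 i j (η k)))
        * (1 - mink i j)
      = flux η i j k * Complex.normSq (cornerNumber i j k) := by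
  obtain ⟨t1, t2, t3⟩ := mink_triangleShift (η := η) h
  have n1 : 1 + mink i j ≠ 0 := by linarith [mink_lt_neg_one hi hj (ne_of_det3_ne_zero h).1]
  have n2 : 1 + mink i k ≠ 0 := by linarith [mink_lt_neg_one hi hk (ne_of_det3_ne_zero h).2.1]
  have n3 : 1 + mink j k ≠ 0 := by linarith [mink_lt_neg_one hj hk (ne_of_det3_ne_zero h).2.2]
  rw [chordRate, eq_div_iff n1] at t1
  rw [chordRate, eq_div_iff n2] at t2
  rw [chordRate, eq_div_iff n3] at t3
  rw [normSq_cornerNumber hi hj hk, flux]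
  generalize triangleShift η i j k = τ at *
  -- The extra factor `det3 i j k` pairs up all determinants. Each pair is a Gram determinant, and a
  -- polynomial identity in Minkowski products remains.
  apply mul_left_cancel₀ h
  have e0 := det3_mul_det3 i j k i j k
  have e1 := det3_mul_det3 i j k (η i) j k
  have e2 := det3_mul_det3 i j k i (η j) k
  have e3 := det3_mul_det3 i j k i j (η k)
  have e4 := det3_mul_det3 i j k i j τ
  simp only [mink_comm j i, mink_comm k i, mink_comm k j, mink_comm _ (η i), mink_comm _ (η j),
    mink_comm _ (η k), hi.1, hj.1, hk.1, ti, tj, tk, mink_comm _ τ] at e0 e1 e2 e3 e4 t1 t2 t3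
  simp only [mink_sub_left, mink_sub_right, mink_comm k j, mink_comm _ (η j), mink_comm _ (η k),
    hk.1, tk]
  generalize mink i j = a at *
  generalize mink i k = b at *
  generalize mink j k = c at *
  generalize mink τ i = u at *
  generalize mink τ j = v at *
  generalize mink τ k = w at *
  generalize mink (η i) j = x1 at *
  generalize mink (η i) k = x2 at *
  generalize mink (η j) i = y1 at *
  generalize mink (η j) k = y2 at *
  generalize mink (η k) i = z1 at *
  generalize mink (η k) j = z2 at *
  have hx : x1 = (u + v) * (1 + a) - y1 := by linarith
  have hy : x2 = (u + w) * (1 + b) - z1 := by linarith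
  have hz : y2 = (v + w) * (1 + c) - z2 := by linarith
  subst hx hy hz
  linear_combination (1 - a) * ((u + v) * (1 + a) - (u + w) * (1 + b) - (v + w) * (1 + c)) * e0
    - (1 - a) * (a - b - c - 1) * (e1 + e2 + e3) - 2 * (1 + b) * (1 + c) * (1 - a) * e4

theorem hasDerivAt_mink {x y : ℝ → Mink} {x' y' : Mink} {t : ℝ} (hx : HasDerivAt x x' t)
    (hy : HasDerivAt y y' t) :
    HasDerivAt (fun s => mink (x s) (y s)) (mink x' (y t) + mink (x t) y') t := by
  have hx' := hasDerivAt_pi.1 hx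
  have hy' := hasDerivAt_pi.1 hy
  simp only [mink]
  refine HasDerivAt.congr_deriv ((((hx' 0).fun_mul (hy' 0)).fun_neg.fun_add ((hx' 1).fun_mul (hy' 1))).fun_add
    ((hx' 2).fun_mul (hy' 2))) ?_
  ring

theorem hasDerivAt_det3 {x y z : ℝ → Mink} {x' y' z' : Mink} {t : ℝ} (hx : HasDerivAt x x' t)
    (hy : HasDerivAt y y' t) (hz : HasDerivAt z z' t) :
    HasDerivAt (fun s => det3 (x s) (y s) (z s))
      (det3 x' (y t) (z t) + det3 (x t) y' (z t) + det3 (x t) (y t) z') t := by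
  have hx' := hasDerivAt_pi.1 hx
  have hy' := hasDerivAt_pi.1 hy
  have hz' := hasDerivAt_pi.1 hz
  simp only [det3]
  refine HasDerivAt.congr_deriv ((((hx' 0).fun_mul (((hy' 1).fun_mul (hz' 2)).fun_sub ((hy' 2).fun_mul (hz' 1)))).fun_sub
    ((hx' 1).fun_mul (((hy' 0).fun_mul (hz' 2)).fun_sub ((hy' 2).fun_mul (hz' 0))))).fun_add
    ((hx' 2).fun_mul (((hy' 0).fun_mul (hz' 1)).fun_sub ((hy' 1).fun_mul (hz' 0))))) ?_
  ring

theorem hasDerivAt_cornerNumber {x y z : ℝ → Mink} {x' y' z' : Mink} {t : ℝ}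
    (hx : HasDerivAt x x' t) (hy : HasDerivAt y y' t) (hz : HasDerivAt z z' t) :
    HasDerivAt (fun s => cornerNumber (x s) (y s) (z s))
      ⟨mink (x' - z') (y t - z t) + mink (x t - z t) (y' - z'),
        -(det3 x' (y t) (z t) + det3 (x t) y' (z t) + det3 (x t) (y t) z')⟩ t := by
  have h1 := (hasDerivAt_mink (hx.fun_sub hz) (hy.fun_sub hz)).ofReal_comp
  have h2 := ((hasDerivAt_det3 hx hy hz).fun_neg.ofReal_comp).mul_const Complex.I
  have e : (fun s => cornerNumber (x s) (y s) (z s)) = fun s =>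
      (mink (x s - z s) (y s - z s) : ℂ) + ((-det3 (x s) (y s) (z s) : ℝ) : ℂ) * Complex.I :=
    funext fun s => Complex.mk_eq_add_mul_I _ _
  rw [e, Complex.mk_eq_add_mul_I]
  exact h1.fun_add h2

/-- Every tangent field is the initial velocity of a motion. -/
theorem exists_isMotion {F : Set (Set Mink)} (hF : ∀ v ∈ vertices F, v ∈ hypPlane)
    {η : Mink → Mink} (hη : IsTangentField F η) : ∃ p, IsMotion F η p := by
  -- The tangent line `v + t η_v`, rescaled to the hyperboloid; by tangency its square is `-(1 - t²
  -- ⟨η_v,η_v⟩)`.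
  refine ⟨fun v t => (Real.sqrt (1 - t ^ 2 * mink (η v) (η v)))⁻¹ • (v + t • η v), ?_⟩
  intro v hv
  have hpos : ∀ᶠ t in nhds (0 : ℝ), 0 < 1 - t ^ 2 * mink (η v) (η v) := by
    have : ContinuousAt (fun t : ℝ => 1 - t ^ 2 * mink (η v) (η v)) 0 := by fun_prop
    exact this.eventually_const_lt (by norm_num)
  have hpos' : ∀ᶠ t in nhds (0 : ℝ), 0 < (v + t • η v) 0 := by
    have : ContinuousAt (fun t : ℝ => v 0 + t * η v 0) 0 := by fun_prop
    exact this.eventually_const_lt (by simpa using (hF v hv).2)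
  have hsqrt : ContDiffAt ℝ ((⊤ : ℕ∞) : WithTop ℕ∞)
      (fun t : ℝ => (Real.sqrt (1 - t ^ 2 * mink (η v) (η v)))⁻¹) 0 := by
    apply ContDiffAt.inv
    · apply ContDiffAt.sqrt
      · fun_prop
      · norm_num
    · norm_num
  refine ⟨by simp, ?_, ?_, ?_⟩
  · filter_upwards [hpos, hpos'] with t h1 h2
    refine ⟨?_, ?_⟩
    · have e : mink (v + t • η v) (v + t • η v) = -(1 - t ^ 2 * mink (η v) (η v)) := by
        simp only [mink_add_left, mink_add_right, mink_smul_left, mink_smul_right,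
          mink_comm v (η v), hη v hv, (hF v hv).1]
        ring
      rw [mink_smul_left, mink_smul_right, e, ← mul_assoc, ← mul_inv, Real.mul_self_sqrt h1.le]
      field_simp
    · rw [Pi.smul_apply, smul_eq_mul]
      exact mul_pos (inv_pos.2 (Real.sqrt_pos.2 h1)) h2
  · exact hsqrt.smul (by fun_prop)
  · have h1 : HasDerivAt (fun t : ℝ => 1 - t ^ 2 * mink (η v) (η v)) 0 0 := by
      have := ((hasDerivAt_pow 2 (0 : ℝ)).mul_const (mink (η v) (η v))).const_sub 1
      simpa using this
    have h2 := (h1.sqrt (by norm_num)).inv (by norm_num)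
    have h3 : HasDerivAt (fun t : ℝ => v + t • η v) (η v) 0 := by
      have := ((hasDerivAt_id (0 : ℝ)).smul_const (η v)).const_add v
      simpa using this
    have := h2.fun_smul h3
    simpa using this

/-- The infinitesimal form of the preservation of the intersection angles: the fluxes agree
on both sides of an edge. -/
theorem flux_eq_of_preservesIntersectionAngles {F : Set (Set Mink)}
    (hF : ∀ v ∈ vertices F, v ∈ hypPlane) {η : Mink → Mink} (hη : IsTangentField F η)
    (hang : PreservesIntersectionAngles F η) {i j k l : Mink} (h : AdjacentTriangles F i j k l)
    (hk : det3 i j k ≠ 0) (hl : det3 i j l ≠ 0) : flux η i j k = flux η i j l := by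
  obtain ⟨p, hp⟩ := exists_isMotion hF hη
  have hiv : i ∈ vertices F := ⟨_, h.1, by simp⟩
  have hjv : j ∈ vertices F := ⟨_, h.1, by simp⟩
  have hkv : k ∈ vertices F := ⟨_, h.1, by simp⟩
  have hlv : l ∈ vertices F := ⟨_, h.2.1, by simp⟩
  obtain ⟨pi0, pi1, -, pi2⟩ := hp i hiv
  obtain ⟨pj0, pj1, -, pj2⟩ := hp j hjv
  obtain ⟨pk0, pk1, -, pk2⟩ := hp k hkv
  obtain ⟨pl0, pl1, -, pl2⟩ := hp l hlv
  have dk := hasDerivAt_cornerNumber pi2 pj2 pk2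
  have dl := hasDerivAt_cornerNumber pi2 pj2 pl2
  have dl' : HasDerivAt (fun s => starRingEnd ℂ (cornerNumber (p i s) (p j s) (p l s))) _ 0 :=
    dl.star
  have d := (dk.mul dl').neg
  have nk : Complex.normSq (cornerNumber i j k) ≠ 0 := by
    rw [Complex.normSq_eq_zero.ne]
    intro h0
    exact hk (neg_eq_zero.1 (congrArg Complex.im h0))
  have nl : Complex.normSq (cornerNumber i j l) ≠ 0 := by
    rw [Complex.normSq_eq_zero.ne]
    intro h0
    exact hl (neg_eq_zero.1 (congrArg Complex.im h0))
  have hne : ∀ᶠ t in nhds (0 : ℝ), cornerNumber (p i t) (p j t) (p k t)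
      * starRingEnd ℂ (cornerNumber (p i t) (p j t) (p l t)) ≠ 0 := by
    apply (dk.mul dl').continuousAt.eventually_ne
    simp only [Pi.mul_apply, pi0, pj0, pk0, pl0]
    rw [ne_eq, mul_eq_zero, map_eq_zero, ← Complex.normSq_eq_zero, ← Complex.normSq_eq_zero]
    tauto
  have ha := hang p hp i j k l h
  have ha' := ha.congr_of_eventuallyEq (f₁ := fun t => Complex.arg
      (-(cornerNumber (p i t) (p j t) (p k t)
        * starRingEnd ℂ (cornerNumber (p i t) (p j t) (p l t))))) (by
    filter_upwards [pi1, pj1, pk1, pl1, hne] with t h1 h2 h3 h4 h5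
    exact (intersectionAngle_eq h1 h2 h3 h4 h5).symm)
  have key := im_mul_conj_eq_zero_of_arg d ha'
  have rk := cornerNumber_rate (hF i hiv) (hF j hjv) (hF k hkv) (hη i hiv) (hη j hjv) (hη k hkv) hk
  have rl := cornerNumber_rate (hF i hiv) (hF j hjv) (hF l hlv) (hη i hiv) (hη j hjv) (hη l hlv) hl
  have hij : 1 - mink i j ≠ 0 := by
    have := mink_le_neg_one (hF i hiv) (hF j hjv)
    linarith
  simp only [pi0, pj0, pk0, pl0, Pi.neg_apply, Pi.mul_apply] at key
  rw [Complex.normSq_apply] at rk rl nk nl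
  simp only [cornerNumber] at key rk rl nk nl
  generalize mink (i - k) (j - k) = a at *
  generalize mink (i - l) (j - l) = b at *
  generalize det3 (η i) j k + det3 i (η j) k + det3 i j (η k) = x at *
  generalize det3 (η i) j l + det3 i (η j) l + det3 i j (η l) = y at *
  generalize mink (η i - η k) (j - k) + mink (i - k) (η j - η k) = z at *
  generalize mink (η i - η l) (j - l) + mink (i - l) (η j - η l) = w at *
  generalize det3 i j k = u at *
  generalize det3 i j l = v at *
  simp at key
  apply mul_left_cancel₀ nk
  apply mul_left_cancel₀ nl
  apply mul_left_cancel₀ hij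
  -- `key` says that both corner arguments turn at the same rate; `rk` and `rl` express these rates
  -- by the fluxes.
  linear_combination -((1 - mink i j) * (b * b + v * v)) * rk + ((1 - mink i j) * (a * a + u * u)) * rl
    + (1 - mink i j) ^ 2 * key

/-! ### Geodesic triangles -/

theorem eq_of_mem_hypPlane_of_smul {x v : Mink} {a : ℝ} (hx : x ∈ hypPlane) (hv : v ∈ hypPlane)
    (h : x = a • v) : x = v := by
  have h1 := hx.1
  rw [h, mink_smul_left, mink_smul_right, hv.1] at h1
  have h0 := hx.2
  rw [h, Pi.smul_apply, smul_eq_mul] at h0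
  have ha : 0 < a := pos_of_mul_pos_left h0 hv.2.le
  have : a = 1 := by nlinarith
  rw [h, this, one_smul]

theorem mink_add_smul_neg {i j : Mink} (hi : i ∈ hypPlane) (hj : j ∈ hypPlane) {a b : ℝ}
    (ha : 0 < a) (hb : 0 ≤ b) :
    mink (a • i + b • j) (a • i + b • j) < 0 ∧ 0 < (a • i + b • j) 0 := by
  constructor
  · simp only [mink_add_left, mink_add_right, mink_smul_left, mink_smul_right, hi.1, hj.1,
      mink_comm j i]
    have h := mul_nonneg (mul_nonneg ha.le hb) (by linarith [mink_le_neg_one hi hj] : 0 ≤ -mink i j)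
    nlinarith [mul_pos ha ha, mul_nonneg hb hb]
  · simp only [Pi.add_apply, Pi.smul_apply, smul_eq_mul]
    exact add_pos_of_pos_of_nonneg (mul_pos ha hi.2) (mul_nonneg hb hj.2.le)

/-- Central projection to the hyperboloid. -/
theorem exists_smul_mem_hypPlane {w : Mink} (h : mink w w < 0) (h0 : 0 < w 0) :
    (Real.sqrt (-mink w w))⁻¹ • w ∈ hypPlane := by
  have hs : 0 < Real.sqrt (-mink w w) := Real.sqrt_pos.2 (by linarith)
  refine ⟨?_, ?_⟩
  · rw [mink_smul_left, mink_smul_right, ← mul_assoc, ← mul_inv, Real.mul_self_sqrt (by linarith)]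
    rw [inv_mul_eq_div, div_eq_iff (by linarith)]
    ring
  · rw [Pi.smul_apply, smul_eq_mul]
    exact mul_pos (inv_pos.2 hs) h0

theorem geodesicSimplex_mono {f g : Set Mink} (h : f ⊆ g) :
    geodesicSimplex f ⊆ geodesicSimplex g := fun _ hx =>
  ⟨hx.1, hx.2.imp fun _ ht => ⟨ht.1, convexHull_mono h ht.2⟩⟩

theorem mem_geodesicSimplex_triple {i j k x : Mink} :
    x ∈ geodesicSimplex {i, j, k} ↔ x ∈ hypPlane ∧
      ∃ a b c : ℝ, 0 ≤ a ∧ 0 ≤ b ∧ 0 ≤ c ∧ x = a • i + b • j + c • k := by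
  constructor
  · rintro ⟨hx, t, ht, hm⟩
    refine ⟨hx, ?_⟩
    have hc : Convex ℝ {y : Mink | ∃ a b c : ℝ, 0 ≤ a ∧ 0 ≤ b ∧ 0 ≤ c ∧
        y = a • i + b • j + c • k} := by
      rintro _ ⟨a, b, c, ha, hb, hc, rfl⟩ _ ⟨a', b', c', ha', hb', hc', rfl⟩ s s' hs hs' -
      exact ⟨s * a + s' * a', s * b + s' * b', s * c + s' * c', by positivity, by positivity,
        by positivity, by module⟩
    have hsub : ({i, j, k} : Set Mink) ⊆ {y : Mink | ∃ a b c : ℝ, 0 ≤ a ∧ 0 ≤ b ∧ 0 ≤ c ∧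
        y = a • i + b • j + c • k} := by
      rintro y (rfl | rfl | rfl)
      · exact ⟨1, 0, 0, by norm_num, by norm_num, by norm_num, by module⟩
      · exact ⟨0, 1, 0, by norm_num, by norm_num, by norm_num, by module⟩
      · exact ⟨0, 0, 1, by norm_num, by norm_num, by norm_num, by module⟩
    obtain ⟨a, b, c, ha, hb, hc', e⟩ := convexHull_min hsub hc hm
    refine ⟨t⁻¹ * a, t⁻¹ * b, t⁻¹ * c, by positivity, by positivity, by positivity, ?_⟩
    have := congrArg (fun y => t⁻¹ • y) e
    simp only [smul_smul, inv_mul_cancel₀ ht.ne', one_smul, smul_add] at this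
    exact this
  · rintro ⟨hx, a, b, c, ha, hb, hc, e⟩
    have hpos : 0 < a + b + c := by
      rcases (by positivity : 0 ≤ a + b + c).eq_or_lt with h | h
      · have h1 : a = 0 := by linarith
        have h2 : b = 0 := by linarith
        have h3 : c = 0 := by linarith
        have := hx.2
        simp [e, h1, h2, h3] at this
      · exact h
    refine ⟨hx, (a + b + c)⁻¹, inv_pos.2 hpos, ?_⟩
    have hconv := convex_convexHull ℝ ({i, j, k} : Set Mink)
    have hi : i ∈ convexHull ℝ ({i, j, k} : Set Mink) := subset_convexHull ℝ _ (by simp)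
    have hj : j ∈ convexHull ℝ ({i, j, k} : Set Mink) := subset_convexHull ℝ _ (by simp)
    have hk : k ∈ convexHull ℝ ({i, j, k} : Set Mink) := subset_convexHull ℝ _ (by simp)
    have := hconv.sum_mem (t := Finset.univ) (w := ![a / (a + b + c), b / (a + b + c),
      c / (a + b + c)]) (z := ![i, j, k]) (by
        intro n _; fin_cases n <;> simp <;> positivity) (by
        simp [Fin.sum_univ_three]; field_simp) (by
        intro n _; fin_cases n <;> simpa)
    simp only [Fin.sum_univ_three, Matrix.cons_val] at this
    convert this using 1
    rw [e]
    simp only [smul_add, smul_smul, div_eq_inv_mul]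

/-- Cramer's rule gives the coordinates as quotients of determinants; the factor `det3 i j k` makes
the sign test independent of orientation. -/
theorem mem_geodesicSimplex_iff {i j k x : Mink} (h : det3 i j k ≠ 0) :
    x ∈ geodesicSimplex {i, j, k} ↔ x ∈ hypPlane ∧ 0 ≤ det3 i j k * det3 x j k ∧
      0 ≤ det3 i j k * det3 i x k ∧ 0 ≤ det3 i j k * det3 i j x := by
  rw [mem_geodesicSimplex_triple]
  refine and_congr_right fun hx => ⟨?_, ?_⟩
  · rintro ⟨a, b, c, ha, hb, hc, rfl⟩
    have e1 : det3 (a • i + b • j + c • k) j k = a * det3 i j k := by simp [det3]; ring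
    have e2 : det3 i (a • i + b • j + c • k) k = b * det3 i j k := by simp [det3]; ring
    have e3 : det3 i j (a • i + b • j + c • k) = c * det3 i j k := by simp [det3]; ring
    rw [e1, e2, e3]
    refine ⟨?_, ?_, ?_⟩
    · nlinarith [mul_nonneg ha (mul_self_nonneg (det3 i j k))]
    · nlinarith [mul_nonneg hb (mul_self_nonneg (det3 i j k))]
    · nlinarith [mul_nonneg hc (mul_self_nonneg (det3 i j k))]
  · rintro ⟨h1, h2, h3⟩
    have hD : 0 < det3 i j k * det3 i j k := mul_self_pos.2 h
    refine ⟨_, _, _, div_nonneg h1 hD.le, div_nonneg h2 hD.le, div_nonneg h3 hD.le, ?_⟩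
    have e := det3_smul_eq i j k x
    simp only [mul_div_mul_left _ _ h, div_eq_inv_mul, mul_smul, ← smul_add, ← e]
    rw [smul_smul, inv_mul_cancel₀ h, one_smul]

theorem isClosed_hypPlane : IsClosed hypPlane := by
  have : hypPlane = {x | mink x x = -1 ∧ 0 ≤ x 0} := by
    ext x
    refine ⟨fun h => ⟨h.1, h.2.le⟩, fun h => ⟨h.1, h.2.lt_of_ne ?_⟩⟩
    intro h0
    have h1 := h.1
    simp only [mink, ← h0] at h1
    nlinarith [mul_self_nonneg (x 1), mul_self_nonneg (x 2)]
  rw [this]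
  have hc : Continuous fun x : Mink => mink x x := by unfold mink; fun_prop
  exact (isClosed_eq hc continuous_const).inter (isClosed_le continuous_const (continuous_apply 0))

theorem isCompact_geodesicSimplex {i j k : Mink} (hi : i ∈ hypPlane) (hj : j ∈ hypPlane)
    (hk : k ∈ hypPlane) (h : det3 i j k ≠ 0) : IsCompact (geodesicSimplex {i, j, k}) := by
  apply Metric.isCompact_of_isClosed_isBounded
  · have : geodesicSimplex {i, j, k} = hypPlane ∩ {x | 0 ≤ det3 i j k * det3 x j k ∧
      0 ≤ det3 i j k * det3 i x k ∧ 0 ≤ det3 i j k * det3 i j x} := by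
      ext x
      exact mem_geodesicSimplex_iff h
    rw [this]
    have c1 : IsClosed {x : Mink | 0 ≤ det3 i j k * det3 x j k} :=
      isClosed_le continuous_const (by unfold det3; fun_prop)
    have c2 : IsClosed {x : Mink | 0 ≤ det3 i j k * det3 i x k} :=
      isClosed_le continuous_const (by unfold det3; fun_prop)
    have c3 : IsClosed {x : Mink | 0 ≤ det3 i j k * det3 i j x} :=
      isClosed_le continuous_const (by unfold det3; fun_prop)
    exact isClosed_hypPlane.inter (c1.inter (c2.inter c3))
  · apply Metric.isBounded_closedBall (x := (0 : Mink)) (r := ‖i‖ + ‖j‖ + ‖k‖) |>.subset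
    intro x hx
    obtain ⟨hx, a, b, c, ha, hb, hc, e⟩ := mem_geodesicSimplex_triple.1 hx
    have h1 := hx.1
    rw [e] at h1
    simp only [mink_add_left, mink_add_right, mink_smul_left, mink_smul_right, hi.1, hj.1, hk.1,
      mink_comm j i, mink_comm k i, mink_comm k j] at h1
    have m1 : 0 ≤ a * b * -mink i j := mul_nonneg (mul_nonneg ha hb)
      (by linarith [mink_le_neg_one hi hj])
    have m2 : 0 ≤ a * c * -mink i k := mul_nonneg (mul_nonneg ha hc)
      (by linarith [mink_le_neg_one hi hk])
    have m3 : 0 ≤ b * c * -mink j k := mul_nonneg (mul_nonneg hb hc)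
      (by linarith [mink_le_neg_one hj hk])
    -- The cross terms in `⟨x,x⟩ = -1` are all nonpositive, since distinct vertices also have
    -- negative product.
    have hsum : a * a + b * b + c * c ≤ 1 := by nlinarith
    have a1 : a ≤ 1 := by nlinarith [mul_self_nonneg b, mul_self_nonneg c]
    have b1 : b ≤ 1 := by nlinarith [mul_self_nonneg a, mul_self_nonneg c]
    have c1 : c ≤ 1 := by nlinarith [mul_self_nonneg b, mul_self_nonneg a]
    rw [mem_closedBall_zero_iff, e]
    refine (norm_add₃_le).trans ?_
    rw [norm_smul, norm_smul, norm_smul, Real.norm_of_nonneg ha, Real.norm_of_nonneg hb,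
      Real.norm_of_nonneg hc]
    gcongr
    · exact mul_le_of_le_one_left (norm_nonneg _) a1
    · exact mul_le_of_le_one_left (norm_nonneg _) b1
    · exact mul_le_of_le_one_left (norm_nonneg _) c1

theorem det3_ne_zero_of_linearIndependent {i j k : Mink} (hij : i ≠ j) (hik : i ≠ k)
    (hjk : j ≠ k) (h : LinearIndependent ℝ (fun v : ({i, j, k} : Set Mink) => (v : Mink))) :
    det3 i j k ≠ 0 := by
  let e : Fin 3 → ({i, j, k} : Set Mink) := ![⟨i, by simp⟩, ⟨j, by simp⟩, ⟨k, by simp⟩]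
  have he : Function.Injective e := by
    intro a b hab
    have hab' := congrArg Subtype.val hab
    fin_cases a <;> fin_cases b <;> first
      | rfl
      | exact absurd hab' hij
      | exact absurd hab' hik
      | exact absurd hab' hjk
      | exact absurd hab' hij.symm
      | exact absurd hab' hik.symm
      | exact absurd hab' hjk.symm
  have h1 := h.comp e he
  have h2 : ((fun v : ({i, j, k} : Set Mink) => (v : Mink)) ∘ e)
      = (Matrix.of ![i, j, k]).row := by
    ext a b
    fin_cases a <;> rfl
  rw [h2, Matrix.linearIndependent_rows_iff_isUnit, Matrix.isUnit_iff_isUnit_det,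
    isUnit_iff_ne_zero, Matrix.det_fin_three] at h1
  intro h0
  apply h1
  rw [← h0]
  simp [det3]
  ring

/-! ### Compactness and local finiteness of the triangulation -/

section Triangulation

variable {Γ : Subgroup (Mink ≃ₗ[ℝ] Mink)} {F : Set (Set Mink)}

theorem IsGeodesicTriangulation.vertices_subset (hF : IsGeodesicTriangulation Γ F) :
    ∀ v ∈ vertices F, v ∈ hypPlane := by
  rintro v ⟨f, hf, hv⟩
  exact hF.subset_hypPlane f hf hv

theorem IsGeodesicTriangulation.det3_ne_zero (hF : IsGeodesicTriangulation Γ F) {i j k : Mink}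
    (h : ({i, j, k} : Set Mink) ∈ F) : det3 i j k ≠ 0 := by
  have h3 := hF.ncard_eq_three _ h
  have hp : ∀ a b : Mink, ({a, b} : Set Mink).ncard ≤ 2 := fun a b =>
    (Set.ncard_insert_le _ _).trans (by rw [Set.ncard_singleton])
  have hij : i ≠ j := by
    rintro rfl
    have := hp i k
    simp at h3
    omega
  have hik : i ≠ k := by
    rintro rfl
    have := hp i j
    rw [show ({i, j, i} : Set Mink) = {i, j} by ext; simp; tauto] at h3
    omega
  have hjk : j ≠ k := by
    rintro rfl
    have := hp i j
    simp at h3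
    omega
  exact det3_ne_zero_of_linearIndependent hij hik hjk (hF.nondegenerate _ h)

theorem IsGeodesicTriangulation.exists_eq_triple (hF : IsGeodesicTriangulation Γ F)
    {f : Set Mink} (hf : f ∈ F) : ∃ i j k, f = {i, j, k} := by
  obtain ⟨i, j, k, -, -, -, h⟩ := Set.ncard_eq_three.1 (hF.ncard_eq_three f hf)
  exact ⟨i, j, k, h⟩

theorem IsGeodesicTriangulation.isCompact (hF : IsGeodesicTriangulation Γ F)
    {f : Set Mink} (hf : f ∈ F) : IsCompact (geodesicSimplex f) := by
  obtain ⟨i, j, k, rfl⟩ := hF.exists_eq_triple hf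
  have hs := hF.subset_hypPlane _ hf
  exact isCompact_geodesicSimplex (hs (by simp)) (hs (by simp)) (hs (by simp)) (hF.det3_ne_zero hf)

theorem IsClosedSurfaceGroup.exists_of_mem_geodesicSimplex_image (hΓ : IsClosedSurfaceGroup Γ)
    {γ : Mink ≃ₗ[ℝ] Mink} (hγ : γ ∈ Γ) {f : Set Mink} {x : Mink}
    (hx : x ∈ geodesicSimplex (γ '' f)) : ∃ y ∈ geodesicSimplex f, γ y = x := by
  obtain ⟨hx, t, ht, hm⟩ := hx
  have h1 : γ '' (convexHull ℝ f) = convexHull ℝ (γ '' f) :=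
    (γ : Mink →ₗ[ℝ] Mink).image_convexHull f
  rw [← h1] at hm
  obtain ⟨z, hz, e⟩ := hm
  refine ⟨γ.symm x, ⟨hΓ.mapsTo γ⁻¹ (Γ.inv_mem hγ) x hx, t, ht, ?_⟩, γ.apply_symm_apply x⟩
  rw [← map_smul, ← e, γ.symm_apply_apply]
  exact hz

/-- Only finitely many triangles meet a compact set. -/
theorem IsGeodesicTriangulation.finite_meet (hΓ : IsClosedSurfaceGroup Γ)
    (hF : IsGeodesicTriangulation Γ F) {K : Set Mink} (hK : IsCompact K) (hKH : K ⊆ hypPlane) :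
    {f | f ∈ F ∧ (geodesicSimplex f ∩ K).Nonempty}.Finite := by
  obtain ⟨F₀, hfin, hsub, hF₀⟩ := hF.finite_mod
  -- With the representative triangles included, a translate `γ g` meeting `K` makes `γ K'` meet
  -- `K'`.
  set K' := K ∪ ⋃ g ∈ F₀, geodesicSimplex g with hK'
  have hc : IsCompact K' := hK.union (hfin.isCompact_biUnion fun g hg => hF.isCompact (hsub hg))
  have hH : K' ⊆ hypPlane :=
    Set.union_subset hKH (Set.iUnion₂_subset fun g _ x hx => hx.1)
  have hγ := hΓ.properlyDiscontinuous K' hc hH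
  refine ((hγ.prod hfin).image fun p => p.1 '' p.2).subset ?_
  rintro f ⟨hf, x, hx, hxK⟩
  obtain ⟨g, hg, γ, hγΓ, rfl⟩ := hF₀ f hf
  obtain ⟨y, hy, e⟩ := hΓ.exists_of_mem_geodesicSimplex_image hγΓ hx
  refine ⟨(γ, g), ⟨⟨hγΓ, x, ⟨y, ?_, e⟩, Or.inl hxK⟩, hg⟩, rfl⟩
  exact Or.inr (Set.mem_biUnion hg hy)

/-- A point close to `x` lies only in triangles which contain `x`. -/
theorem IsGeodesicTriangulation.eventually_mem (hΓ : IsClosedSurfaceGroup Γ)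
    (hF : IsGeodesicTriangulation Γ F) (x : Mink) :
    ∀ᶠ y in nhds x, ∀ f ∈ F, y ∈ geodesicSimplex f → x ∈ geodesicSimplex f := by
  have hfin := hF.finite_meet hΓ ((isCompact_closedBall x 1).inter_right isClosed_hypPlane)
    Set.inter_subset_right
  have h1 : ∀ᶠ y in nhds x, ∀ f ∈ {f | f ∈ F ∧
      (geodesicSimplex f ∩ (Metric.closedBall x 1 ∩ hypPlane)).Nonempty},
      y ∈ geodesicSimplex f → x ∈ geodesicSimplex f := by
    rw [Filter.eventually_all_finite hfin]
    intro f hf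
    by_cases hx : x ∈ geodesicSimplex f
    · exact Filter.Eventually.of_forall fun _ _ => hx
    · filter_upwards [(hF.isCompact hf.1).isClosed.isOpen_compl.mem_nhds hx] with y hy hy'
      exact absurd hy' hy
  filter_upwards [h1, Metric.closedBall_mem_nhds x one_pos] with y hy hb f hf hyf
  exact hy f ⟨hf, y, hyf, hb, hyf.1⟩ hyf

theorem IsGeodesicTriangulation.countable (hΓ : IsClosedSurfaceGroup Γ)
    (hF : IsGeodesicTriangulation Γ F) : (vertices F).Countable := by
  have hc : F.Countable := by
    have : F ⊆ ⋃ n : ℕ, {f | f ∈ F ∧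
        (geodesicSimplex f ∩ (Metric.closedBall 0 n ∩ hypPlane)).Nonempty} := by
      intro f hf
      obtain ⟨i, j, k, rfl⟩ := hF.exists_eq_triple hf
      have hi : i ∈ hypPlane := hF.subset_hypPlane _ hf (by simp)
      obtain ⟨n, hn⟩ := exists_nat_ge ‖i‖
      refine Set.mem_iUnion.2 ⟨n, hf, i, ⟨hi, 1, one_pos, ?_⟩, by simpa using hn, hi⟩
      rw [one_smul]
      exact subset_convexHull ℝ _ (by simp)
    refine (Set.countable_iUnion fun n => Set.Finite.countable ?_).mono this
    exact hF.finite_meet hΓ ((isCompact_closedBall _ _).inter_right isClosed_hypPlane)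
      Set.inter_subset_right
  refine hc.sUnion fun f hf => ?_
  exact (Set.finite_of_ncard_ne_zero (by rw [hF.ncard_eq_three f hf]; norm_num)).countable

end Triangulation

/-! ### The two sides of an edge -/

/-- The central projection to the hyperboloid of `i + j + ε u`. -/
noncomputable def nearMidpoint (i j u : Mink) (ε : ℝ) : Mink :=
  (Real.sqrt (-mink (i + j + ε • u) (i + j + ε • u)))⁻¹ • (i + j + ε • u)

theorem mink_midpoint_neg {i j : Mink} (hi : i ∈ hypPlane) (hj : j ∈ hypPlane) :
    mink (i + j) (i + j) < 0 ∧ 0 < (i + j) 0 := by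
  simpa using mink_add_smul_neg hi hj one_pos zero_le_one

theorem eventually_nearMidpoint_mem {i j : Mink} (hi : i ∈ hypPlane) (hj : j ∈ hypPlane)
    (u : Mink) : ∀ᶠ ε in nhds (0 : ℝ), nearMidpoint i j u ε ∈ hypPlane ∧
      ∃ s > (0 : ℝ), nearMidpoint i j u ε = s • (i + j + ε • u) := by
  obtain ⟨h1, h2⟩ := mink_midpoint_neg hi hj
  have c1 : ContinuousAt (fun ε : ℝ => mink (i + j + ε • u) (i + j + ε • u)) 0 := by
    unfold mink; fun_prop
  have c2 : ContinuousAt (fun ε : ℝ => (i + j + ε • u) 0) 0 := by fun_prop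
  filter_upwards [c1.eventually_lt_const (by simpa using h1), c2.eventually_const_lt
    (by simpa using h2)] with ε e1 e2
  exact ⟨exists_smul_mem_hypPlane e1 e2, _, inv_pos.2 (Real.sqrt_pos.2 (by linarith)), rfl⟩

theorem continuousAt_nearMidpoint {i j : Mink} (hi : i ∈ hypPlane) (hj : j ∈ hypPlane)
    (u : Mink) : ContinuousAt (nearMidpoint i j u) 0 := by
  obtain ⟨h1, -⟩ := mink_midpoint_neg hi hj
  have c1 : ContinuousAt (fun ε : ℝ => mink (i + j + ε • u) (i + j + ε • u)) 0 := by
    unfold mink; fun_prop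
  refine ContinuousAt.smul (ContinuousAt.inv₀ c1.neg.sqrt ?_) (by fun_prop)
  apply ne_of_gt
  apply Real.sqrt_pos.2
  simpa using h1

theorem det3_smul_combination (i j k u : Mink) (s ε : ℝ) :
    det3 (s • (i + j + ε • u)) j k = s * (det3 i j k + ε * det3 u j k) ∧
    det3 i (s • (i + j + ε • u)) k = s * (det3 i j k + ε * det3 i u k) ∧
    det3 i j (s • (i + j + ε • u)) = s * (ε * det3 i j u) := by
  refine ⟨?_, ?_, ?_⟩ <;> simp [det3] <;> ring

/-- Both barycentric coordinates along the edge stay positive near its midpoint. -/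
theorem eventually_coordinates_pos {i j k : Mink} (h : det3 i j k ≠ 0) (u : Mink) :
    ∀ᶠ ε in nhds (0 : ℝ), 0 < det3 i j k * (det3 i j k + ε * det3 u j k) ∧
      0 < det3 i j k * (det3 i j k + ε * det3 i u k) := by
  have hD := mul_self_pos.2 h
  have c1 : ContinuousAt (fun ε : ℝ => det3 i j k * (det3 i j k + ε * det3 u j k)) 0 := by fun_prop
  have c2 : ContinuousAt (fun ε : ℝ => det3 i j k * (det3 i j k + ε * det3 i u k)) 0 := by fun_prop
  exact (c1.eventually_const_lt (by simpa using h)).and (c2.eventually_const_lt (by simpa using h))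

theorem exists_eq_combination_of_mem_pair {i j x : Mink} (h : x ∈ geodesicSimplex {i, j}) :
    ∃ a b : ℝ, x = a • i + b • j := by
  rw [show ({i, j} : Set Mink) = {i, j, j} by simp] at h
  obtain ⟨-, a, b, c, -, -, -, e⟩ := mem_geodesicSimplex_triple.1 h
  exact ⟨a, b + c, by rw [e]; module⟩

section Triangulation

variable {Γ : Subgroup (Mink ≃ₗ[ℝ] Mink)} {F : Set (Set Mink)}

/-- Two triangles with a common edge lie on different sides of it. -/
theorem IsGeodesicTriangulation.det3_mul_neg (hF : IsGeodesicTriangulation Γ F) {i j k l : Mink}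
    (h : AdjacentTriangles F i j k l) : det3 i j k * det3 i j l < 0 := by
  obtain ⟨hf, hg, hkl⟩ := h
  have hk := hF.det3_ne_zero hf
  have hl := hF.det3_ne_zero hg
  have hi : i ∈ hypPlane := hF.subset_hypPlane _ hf (by simp)
  have hj : j ∈ hypPlane := hF.subset_hypPlane _ hf (by simp)
  by_contra hc
  have hpos : 0 < det3 i j k * det3 i j l := (not_lt.1 hc).lt_of_ne (mul_ne_zero hk hl).symm
  -- If `k` and `l` were on the same side, a point just off the midpoint of `ij` towards `l` would
  -- lie in both triangles but not on their common edge.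
  have ev := ((eventually_nearMidpoint_mem hi hj l).and (eventually_coordinates_pos hk l))
  obtain ⟨ε, ⟨⟨hx, s, hs, e⟩, h1, h2⟩, hε⟩ :=
    ((ev.filter_mono nhdsWithin_le_nhds).and (self_mem_nhdsWithin (s := Set.Ioi (0 : ℝ)))).exists
  have hε : 0 < ε := hε
  obtain ⟨d1, d2, d3⟩ := det3_smul_combination i j k l s ε
  rw [← e] at d1 d2 d3
  have m1 : nearMidpoint i j l ε ∈ geodesicSimplex {i, j, k} := by
    refine (mem_geodesicSimplex_iff hk).2 ⟨hx, ?_, ?_, ?_⟩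
    · rw [d1]; nlinarith
    · rw [d2]; nlinarith
    · rw [d3]; have := mul_pos (mul_pos hs hε) hpos; nlinarith
  have m2 : nearMidpoint i j l ε ∈ geodesicSimplex {i, j, l} := by
    refine mem_geodesicSimplex_triple.2 ⟨hx, s, s, s * ε, hs.le, hs.le, by positivity, ?_⟩
    rw [e]; module
  have m3 : nearMidpoint i j l ε ∈ geodesicSimplex ({i, j, k} ∩ {i, j, l}) := by
    rw [← hF.face_to_face _ hf _ hg]; exact ⟨m1, m2⟩
  have hsub : ({i, j, k} ∩ {i, j, l} : Set Mink) ⊆ {i, j} := by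
    rintro y ⟨hy1, hy2⟩
    simp only [Set.mem_insert_iff, Set.mem_singleton_iff] at *
    rcases hy1 with h | h | h
    · exact Or.inl h
    · exact Or.inr h
    · rcases hy2 with h' | h' | h'
      · exact Or.inl h'
      · exact Or.inr h'
      · exact absurd (h.symm.trans h') hkl
  obtain ⟨a, b, e'⟩ := exists_eq_combination_of_mem_pair (geodesicSimplex_mono hsub m3)
  have : det3 i j (nearMidpoint i j l ε) = 0 := by rw [e']; simp [det3]; ring
  rw [d3] at this
  exact mul_ne_zero hs.ne' (mul_ne_zero hε.ne' hl) this

theorem IsGeodesicTriangulation.adjacent_unique (hF : IsGeodesicTriangulation Γ F)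
    {i j k l l' : Mink} (h : AdjacentTriangles F i j k l) (h' : AdjacentTriangles F i j k l') :
    l = l' := by
  by_contra hne
  have h1 := hF.det3_mul_neg h
  have h2 := hF.det3_mul_neg h'
  have h3 := hF.det3_mul_neg ⟨h.2.1, h'.2.1, hne⟩
  have := mul_pos_of_neg_of_neg h1 h2
  nlinarith [mul_self_nonneg (det3 i j k)]

theorem IsGeodesicTriangulation.exists_third (hF : IsGeodesicTriangulation Γ F) {f : Set Mink}
    (hf : f ∈ F) {i j : Mink} (hi : i ∈ f) (hj : j ∈ f) (hij : i ≠ j) :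
    ∃ k, f = {i, j, k} := by
  have hsub : ({i, j} : Set Mink) ⊆ f := Set.pair_subset hi hj
  have h1 : (f \ {i, j}).ncard = 1 := by
    rw [Set.ncard_sdiff hsub, hF.ncard_eq_three f hf, Set.ncard_pair hij]
  obtain ⟨k, hk⟩ := Set.ncard_eq_one.1 h1
  refine ⟨k, ?_⟩
  rw [← Set.sdiff_union_of_subset hsub, hk]
  ext; simp

theorem IsGeodesicTriangulation.midpoint_mem (hF : IsGeodesicTriangulation Γ F) {i j k : Mink}
    (hf : ({i, j, k} : Set Mink) ∈ F) : ∃ x ∈ geodesicSimplex {i, j, k}, ∃ s > (0 : ℝ),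
      x = s • (i + j) ∧ ∀ u, x = nearMidpoint i j u 0 := by
  have hi : i ∈ hypPlane := hF.subset_hypPlane _ hf (by simp)
  have hj : j ∈ hypPlane := hF.subset_hypPlane _ hf (by simp)
  obtain ⟨h, s, hs, e⟩ := (eventually_nearMidpoint_mem hi hj 0).self_of_nhds
  refine ⟨_, mem_geodesicSimplex_triple.2 ⟨h, s, s, 0, hs.le, hs.le, le_rfl, ?_⟩, s, hs, ?_, ?_⟩
  · rw [e]; module
  · rw [e]; module
  · intro u; simp [nearMidpoint]

/-- Every edge of a triangle is an edge of a second triangle. -/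
theorem IsGeodesicTriangulation.exists_adjacent (hΓ : IsClosedSurfaceGroup Γ)
    (hF : IsGeodesicTriangulation Γ F) {i j k : Mink} (hf : ({i, j, k} : Set Mink) ∈ F) :
    ∃ l, AdjacentTriangles F i j k l := by
  have hk := hF.det3_ne_zero hf
  have hi : i ∈ hypPlane := hF.subset_hypPlane _ hf (by simp)
  have hj : j ∈ hypPlane := hF.subset_hypPlane _ hf (by simp)
  obtain ⟨x, hxf, r, hr, ex, hx0⟩ := hF.midpoint_mem hf
  -- Push the midpoint of `ij` slightly away from `k`: by local finiteness, a triangle covering the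
  -- new point also contains the midpoint.
  have ev := (continuousAt_nearMidpoint hi hj (-k)).eventually
    (by rw [← hx0 (-k)]; exact hF.eventually_mem hΓ x)
  obtain ⟨ε, ⟨⟨hx, s, hs, e⟩, hev⟩, hε⟩ :=
    ((((eventually_nearMidpoint_mem hi hj (-k)).and ev).filter_mono nhdsWithin_le_nhds).and
      (self_mem_nhdsWithin (s := Set.Ioi (0 : ℝ)))).exists
  have hε : 0 < ε := hε
  obtain ⟨g, hg, hgx⟩ := hF.covers _ hx
  have hxg := hev g hg hgx
  have hfg : x ∈ geodesicSimplex ({i, j, k} ∩ g) := by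
    rw [← hF.face_to_face _ hf _ hg]; exact ⟨hxf, hxg⟩
  -- The midpoint lies in the simplex of the common vertices and has nonzero coordinates at `i` and
  -- `j`, so neither may be missing from `g`.
  have hig : i ∈ g := by
    by_contra hig
    have hsub : ({i, j, k} ∩ g : Set Mink) ⊆ {j, k} := by
      rintro y ⟨rfl | hy, hy'⟩
      · exact absurd hy' hig
      · exact hy
    obtain ⟨a, b, e'⟩ := exists_eq_combination_of_mem_pair (geodesicSimplex_mono hsub hfg)
    have h1 : det3 x j k = 0 := by rw [e']; simp [det3]; ring
    have h2 : det3 x j k = r * det3 i j k := by rw [ex]; simp [det3]; ring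
    exact mul_ne_zero hr.ne' hk (h2.symm.trans h1)
  have hjg : j ∈ g := by
    by_contra hjg
    have hsub : ({i, j, k} ∩ g : Set Mink) ⊆ {i, k} := by
      rintro y ⟨rfl | rfl | hy, hy'⟩
      · simp
      · exact absurd hy' hjg
      · exact Or.inr hy
    obtain ⟨a, b, e'⟩ := exists_eq_combination_of_mem_pair (geodesicSimplex_mono hsub hfg)
    have h1 : det3 i x k = 0 := by rw [e']; simp [det3]; ring
    have h2 : det3 i x k = r * det3 i j k := by rw [ex]; simp [det3]; ring
    exact mul_ne_zero hr.ne' hk (h2.symm.trans h1)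
  obtain ⟨l, rfl⟩ := hF.exists_third hg hig hjg (ne_of_det3_ne_zero hk).1
  refine ⟨l, hf, hg, ?_⟩
  rintro rfl
  obtain ⟨-, -, -, h3⟩ := (mem_geodesicSimplex_iff hk).1 hgx
  rw [e, (det3_smul_combination i j k (-k) s ε).2.2] at h3
  have h4 : det3 i j (-k) = -det3 i j k := by simp [det3]; ring
  rw [h4] at h3
  have := mul_pos (mul_pos hs hε) (mul_self_pos.2 hk)
  nlinarith

/-- Otherwise face-to-face would make `v` a combination of the two other vertices of its own
triangle, which is nondegenerate. -/
theorem IsGeodesicTriangulation.mem_of_mem_geodesicSimplex (hF : IsGeodesicTriangulation Γ F)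
    {f : Set Mink} (hf : f ∈ F) {v : Mink} (hv : v ∈ vertices F) (h : v ∈ geodesicSimplex f) :
    v ∈ f := by
  obtain ⟨g, hg, hvg⟩ := hv
  by_contra hvf
  have h1 : (g \ {v}).ncard = 2 := by
    rw [Set.ncard_sdiff (by simpa using hvg), hF.ncard_eq_three g hg, Set.ncard_singleton]
  obtain ⟨a, b, -, hab⟩ := Set.ncard_eq_two.1 h1
  have hge : g = {v, a, b} := by
    rw [← Set.sdiff_union_of_subset (Set.singleton_subset_iff.2 hvg), hab]
    ext; simp
  have hvH := hF.subset_hypPlane _ hg hvg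
  have hvg' : v ∈ geodesicSimplex g :=
    ⟨hvH, 1, one_pos, by rw [one_smul]; exact subset_convexHull ℝ _ hvg⟩
  have hfg : v ∈ geodesicSimplex (f ∩ g) := by
    rw [← hF.face_to_face _ hf _ hg]; exact ⟨h, hvg'⟩
  have hsub : f ∩ g ⊆ {a, b} := by
    rintro y ⟨hy, hy'⟩
    rw [← hab]
    exact ⟨hy', fun hyv => hvf (hyv ▸ hy)⟩
  obtain ⟨c, d, e'⟩ := exists_eq_combination_of_mem_pair (geodesicSimplex_mono hsub hfg)
  rw [hge] at hg
  apply hF.det3_ne_zero hg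
  rw [e']
  simp [det3]
  ring

/-! ### Connectedness through common edges -/

/-- A parametrization of the hyperbolic plane. -/
noncomputable def hypChart (p : ℝ × ℝ) : Mink := ![Real.sqrt (1 + p.1 ^ 2 + p.2 ^ 2), p.1, p.2]

theorem continuous_hypChart : Continuous hypChart := by
  refine continuous_pi fun n => ?_
  fin_cases n <;> simp [hypChart] <;> fun_prop

theorem hypChart_mem (p : ℝ × ℝ) : hypChart p ∈ hypPlane := by
  have h : 0 < 1 + p.1 ^ 2 + p.2 ^ 2 := by positivity
  refine ⟨?_, by simpa [hypChart] using h⟩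
  simp [mink, hypChart, Real.mul_self_sqrt h.le]
  ring

theorem hypChart_apply_of_mem {x : Mink} (hx : x ∈ hypPlane) : hypChart (x 1, x 2) = x := by
  have h : Real.sqrt (1 + x 1 ^ 2 + x 2 ^ 2) = x 0 := by
    rw [Real.sqrt_eq_iff_mul_self_eq (by positivity) hx.2.le]
    have := hx.1
    simp only [mink] at this
    linarith
  ext n
  fin_cases n
  · exact h
  · rfl
  · rfl

/-- A quantity attached to the triangles which agrees for triangles with a common edge is
constant. -/
theorem IsGeodesicTriangulation.eq_of_adjacent {X : Type*} (hΓ : IsClosedSurfaceGroup Γ)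
    (hF : IsGeodesicTriangulation Γ F) (B : Set Mink → X)
    (hB : ∀ i j k l, AdjacentTriangles F i j k l → B {i, j, k} = B {i, j, l})
    {f g : Set Mink} (hf : f ∈ F) (hg : g ∈ F) : B f = B g := by
  -- By local finiteness, any union of triangles is closed.
  have hclosed : ∀ P : Set Mink → Prop,
      IsClosed {p | ∃ f ∈ F, P f ∧ hypChart p ∈ geodesicSimplex f} := by
    intro P
    rw [← isOpen_compl_iff, isOpen_iff_mem_nhds]
    intro p hp
    filter_upwards [continuous_hypChart.continuousAt.eventually
      (hF.eventually_mem hΓ (hypChart p))] with q hq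
    rintro ⟨f, hf, hP, hm⟩
    exact hp ⟨f, hf, hP, hq f hf hm⟩
  have hnonempty : ∀ f ∈ F, ∃ p, hypChart p ∉ vertices F ∧ hypChart p ∈ geodesicSimplex f := by
    intro f hf
    obtain ⟨i, j, k, rfl⟩ := hF.exists_eq_triple hf
    obtain ⟨x, hx, s, hs, e, -⟩ := hF.midpoint_mem hf
    refine ⟨(x 1, x 2), ?_, ?_⟩
    · rw [hypChart_apply_of_mem hx.1]
      intro hv
      have hD := mul_ne_zero hs.ne' (hF.det3_ne_zero hf)
      have h1 : det3 x j k = s * det3 i j k := by rw [e]; simp [det3]; ring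
      have h2 : det3 i x k = s * det3 i j k := by rw [e]; simp [det3]; ring
      rw [← h1] at hD
      obtain ⟨e1, e2, -⟩ := ne_of_det3_ne_zero hD
      rw [h1, ← h2] at hD
      have e3 := (ne_of_det3_ne_zero hD).1
      rcases hF.mem_of_mem_geodesicSimplex hf hv hx with h | h | h
      · exact e3 h.symm
      · exact e1 h
      · exact e2 h
    · rwa [hypChart_apply_of_mem hx.1]
  -- Two triangles sharing a point that is no vertex have at least two common vertices, so they are
  -- equal or adjacent.
  have hcommon : ∀ f ∈ F, ∀ g ∈ F, ∀ x, x ∉ vertices F → x ∈ geodesicSimplex f →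
      x ∈ geodesicSimplex g → B f = B g := by
    intro f hf g hg x hx hxf hxg
    have hfg : x ∈ geodesicSimplex (f ∩ g) := by
      rw [← hF.face_to_face _ hf _ hg]; exact ⟨hxf, hxg⟩
    by_cases hs : (f ∩ g).Subsingleton
    · exfalso
      rcases hs.eq_empty_or_singleton with h0 | ⟨v, h0⟩
      · rw [h0] at hfg
        obtain ⟨-, t, -, ht⟩ := hfg
        simp at ht
      · rw [h0, show ({v} : Set Mink) = {v, v} by simp] at hfg
        obtain ⟨a, b, e⟩ := exists_eq_combination_of_mem_pair hfg
        rw [← add_smul] at e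
        have hvf : v ∈ f := (h0 ▸ Set.mem_singleton v : v ∈ f ∩ g).1
        have := eq_of_mem_hypPlane_of_smul hfg.1 (hF.subset_hypPlane f hf hvf) e
        exact hx ⟨f, hf, this ▸ hvf⟩
    · obtain ⟨i, hi, j, hj, hij⟩ := Set.not_subsingleton_iff.1 hs
      obtain ⟨k, rfl⟩ := hF.exists_third hf hi.1 hj.1 hij
      obtain ⟨l, rfl⟩ := hF.exists_third hg hi.2 hj.2 hij
      by_cases hkl : k = l
      · rw [hkl]
      · exact hB i j k l ⟨hf, hg, hkl⟩
  have hinj : Function.Injective hypChart := by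
    intro p q h
    exact Prod.ext (congrFun h 1) (congrFun h 2)
  -- The plane minus a countable set is connected, so it cannot be split by two closed unions of
  -- triangles that meet only in vertices.
  have hconn : IsPreconnected {p | hypChart p ∉ vertices F} := by
    have := Set.Countable.isConnected_compl_of_one_lt_rank (E := ℝ × ℝ) (by simp; norm_num)
      ((hF.countable hΓ).preimage_of_injOn hinj.injOn)
    exact this.isPreconnected
  by_contra hne
  rw [isPreconnected_closed_iff] at hconn
  obtain ⟨p, hp, hpf⟩ := hnonempty f hf
  obtain ⟨q, hq, hqg⟩ := hnonempty g hg
  obtain ⟨r, hr, ⟨f₁, hf₁, hP₁, hm₁⟩, f₂, hf₂, hP₂, hm₂⟩ :=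
    hconn _ _ (hclosed fun h => B h = B f) (hclosed fun h => B h ≠ B f) (by
      intro r _
      obtain ⟨h, hh, hm⟩ := hF.covers _ (hypChart_mem r)
      by_cases hP : B h = B f
      · exact Or.inl ⟨h, hh, hP, hm⟩
      · exact Or.inr ⟨h, hh, hP, hm⟩)
      ⟨p, hp, f, hf, rfl, hpf⟩ ⟨q, hq, g, hg, fun h => hne h.symm, hqg⟩
  exact hP₂ ((hcommon f₂ hf₂ f₁ hf₁ _ hr hm₂ hm₁).trans hP₁)

end Triangulation

/-! ### The energy identity -/

theorem sum_out_comp {T : Type*} {r : Setoid T} [Fintype (Quotient r)] {W : T → ℝ}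
    (hW : ∀ s t, r s t → W s = W t) {φ : T → T} (hφ : ∀ s t, r s t → r (φ s) (φ t))
    (hb : Function.Bijective (Quotient.map φ hφ : Quotient r → Quotient r)) :
    ∑ q : Quotient r, W (φ q.out) = ∑ q : Quotient r, W q.out := by
  refine (Finset.sum_congr rfl fun q _ => ?_).trans (hb.sum_comp fun q => W q.out)
  apply hW
  apply Quotient.exact
  rw [Quotient.out_eq]
  conv_rhs => rw [← Quotient.out_eq q]
  rfl

/-- An energy identity: a potential `U` on triangles whose fluxes `σ` through the edges are
directed towards smaller potential and have total `-D U` vanishes. The corners `T` are considered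
up to the equivalence relation `r`; `ρ` rotates a triangle and `α` goes to the adjacent one. -/
theorem potential_eq_zero {T : Type*} (r : Setoid T) [Finite (Quotient r)] {U σ D : T → ℝ}
    {ρ α : T → T} (hρ : ∀ t, ρ (ρ (ρ t)) = t) (hα : ∀ t, α (α t) = t)
    (rρ : ∀ s t, r s t → r (ρ s) (ρ t)) (rα : ∀ s t, r s t → r (α s) (α t))
    (rU : ∀ s t, r s t → U s = U t) (rσ : ∀ s t, r s t → σ s = σ t)
    (hD : ∀ t, 0 < D t) (hUρ : ∀ t, U (ρ t) = U t)
    (hsum : ∀ t, σ t + σ (ρ t) + σ (ρ (ρ t)) = -D t * U t) (hσ : ∀ t, σ (α t) = -σ t)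
    (hmono : ∀ t, 0 ≤ (U t - U (α t)) * σ t) (t : T) : U t = 0 := by
  classical
  have := Fintype.ofFinite (Quotient r)
  have bρ : Function.Bijective (Quotient.map ρ rρ : Quotient r → Quotient r) := by
    refine Function.bijective_iff_has_inverse.2
      ⟨fun q => Quotient.map ρ rρ (Quotient.map ρ rρ q), ?_, ?_⟩ <;>
    · intro q
      induction q using Quotient.inductionOn with
      | h t => simp [Quotient.map_mk, hρ]
  have bα : Function.Bijective (Quotient.map α rα : Quotient r → Quotient r) := by
    refine Function.bijective_iff_has_inverse.2 ⟨Quotient.map α rα, ?_, ?_⟩ <;>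
    · intro q
      induction q using Quotient.inductionOn with
      | h t => simp [Quotient.map_mk, hα]
  have hW : ∀ s t, r s t → U s * σ s = U t * σ t := fun s t h => by rw [rU s t h, rσ s t h]
  have s1 := sum_out_comp hW rρ bρ
  have s2 := sum_out_comp (W := fun t => U (ρ t) * σ (ρ t))
    (fun s t h => hW _ _ (rρ s t h)) rρ bρ
  have s3 := sum_out_comp hW rα bα
  set S := ∑ q : Quotient r, U q.out * σ q.out
  -- Summing `U σ` around triangles (via `ρ`) gives minus the energy; summing across edges (via `α`,
  -- in `e2`) gives a nonnegative number.
  have e1 : 3 * S = ∑ q : Quotient r, -(D q.out * U q.out ^ 2) := by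
    have : 3 * S = S + ∑ q : Quotient r, U (ρ q.out) * σ (ρ q.out)
        + ∑ q : Quotient r, U (ρ (ρ q.out)) * σ (ρ (ρ q.out)) := by rw [s2, s1]; ring
    rw [this, ← Finset.sum_add_distrib, ← Finset.sum_add_distrib]
    refine Finset.sum_congr rfl fun q _ => ?_
    simp only [hUρ]
    linear_combination U q.out * hsum q.out
  have e2 : 0 ≤ 2 * S := by
    have : 2 * S = S + ∑ q : Quotient r, U (α q.out) * σ (α q.out) := by rw [s3]; ring
    rw [this, ← Finset.sum_add_distrib]
    refine Finset.sum_nonneg fun q _ => ?_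
    have := hmono q.out
    rw [hσ]
    linarith
  have e3 : ∑ q : Quotient r, D q.out * U q.out ^ 2 = 0 := by
    refine le_antisymm ?_ (Finset.sum_nonneg fun q _ => mul_nonneg (hD _).le (sq_nonneg _))
    rw [Finset.sum_neg_distrib] at e1
    linarith
  rw [Finset.sum_eq_zero_iff_of_nonneg fun q _ => mul_nonneg (hD _).le (sq_nonneg _)] at e3
  have := e3 ⟦t⟧ (Finset.mem_univ _)
  rw [rU t _ (Quotient.exact (Quotient.out_eq _).symm)]
  simpa [(hD _).ne'] using this

/-! ### Vanishing of radial rates and fluxes -/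

section Triangulation

variable {Γ : Subgroup (Mink ≃ₗ[ℝ] Mink)} {F : Set (Set Mink)}

/-- The triangles with an ordering of their vertices. -/
abbrev Corner (F : Set (Set Mink)) : Type :=
  {t : Mink × Mink × Mink // ({t.1, t.2.1, t.2.2} : Set Mink) ∈ F}

/-- Two ordered triangles are equivalent if they are in the same orbit. -/
def cornerSetoid (Γ : Subgroup (Mink ≃ₗ[ℝ] Mink)) (F : Set (Set Mink)) : Setoid (Corner F) where
  r s t := ∃ γ ∈ Γ, γ s.1.1 = t.1.1 ∧ γ s.1.2.1 = t.1.2.1 ∧ γ s.1.2.2 = t.1.2.2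
  iseqv := by
    refine ⟨fun s => ⟨1, Γ.one_mem, rfl, rfl, rfl⟩, ?_, ?_⟩
    · rintro s t ⟨γ, hγ, h1, h2, h3⟩
      refine ⟨γ⁻¹, Γ.inv_mem hγ, ?_, ?_, ?_⟩
      · rw [← h1]; exact γ.symm_apply_apply _
      · rw [← h2]; exact γ.symm_apply_apply _
      · rw [← h3]; exact γ.symm_apply_apply _
    · rintro s t u ⟨γ, hγ, h1, h2, h3⟩ ⟨δ, hδ, k1, k2, k3⟩
      refine ⟨δ * γ, Γ.mul_mem hδ hγ, ?_, ?_, ?_⟩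
      · rw [← k1, ← h1]; rfl
      · rw [← k2, ← h2]; rfl
      · rw [← k3, ← h3]; rfl

theorem IsGeodesicTriangulation.finite_quotient (hF : IsGeodesicTriangulation Γ F) :
    Finite (Quotient (cornerSetoid Γ F)) := by
  obtain ⟨F₀, hfin, hsub, hF₀⟩ := hF.finite_mod
  have hV : (⋃₀ F₀).Finite := hfin.sUnion fun f hf =>
    Set.finite_of_ncard_ne_zero (by rw [hF.ncard_eq_three f (hsub hf)]; norm_num)
  have hT : {t : Corner F | t.1 ∈ (⋃₀ F₀) ×ˢ (⋃₀ F₀) ×ˢ (⋃₀ F₀)}.Finite :=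
    (hV.prod (hV.prod hV)).preimage Subtype.val_injective.injOn
  have := hT.to_subtype
  refine Finite.of_surjective
    (fun t : {t : Corner F | t.1 ∈ (⋃₀ F₀) ×ˢ (⋃₀ F₀) ×ˢ (⋃₀ F₀)} =>
      (Quotient.mk (cornerSetoid Γ F) t.1)) ?_
  intro q
  induction q using Quotient.inductionOn with
  | h t =>
    obtain ⟨⟨i, j, k⟩, h⟩ := t
    obtain ⟨g, hg, γ, hγ, e⟩ := hF₀ _ h
    dsimp only at e h
    have hmem : ∀ v ∈ ({i, j, k} : Set Mink), ∃ w ∈ g, γ w = v := by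
      intro v hv; rw [e] at hv; exact hv
    obtain ⟨i', hi', rfl⟩ := hmem i (by simp)
    obtain ⟨j', hj', rfl⟩ := hmem j (by simp)
    obtain ⟨k', hk', rfl⟩ := hmem k (by simp)
    have e' : ({i', j', k'} : Set Mink) = g := by
      apply γ.injective.image_injective
      rw [← e, Set.image_insert_eq, Set.image_pair]
    refine ⟨⟨⟨(i', j', k'), ?_⟩, ⟨g, hg, hi'⟩, ⟨g, hg, hj'⟩, ⟨g, hg, hk'⟩⟩, ?_⟩
    · change ({i', j', k'} : Set Mink) ∈ F
      rw [e']; exact hsub hg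
    · exact Quotient.sound ⟨γ, hγ, rfl, rfl, rfl⟩

theorem IsGeodesicTriangulation.adjacent_map (hF : IsGeodesicTriangulation Γ F)
    {γ : Mink ≃ₗ[ℝ] Mink} (hγ : γ ∈ Γ) {i j k l : Mink} (h : AdjacentTriangles F i j k l) :
    AdjacentTriangles F (γ i) (γ j) (γ k) (γ l) := by
  refine ⟨?_, ?_, γ.injective.ne h.2.2⟩
  · have := hF.invariant γ hγ _ h.1
    rwa [Set.image_insert_eq, Set.image_pair] at this
  · have := hF.invariant γ hγ _ h.2.1
    rwa [Set.image_insert_eq, Set.image_pair] at this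

theorem AdjacentTriangles.symm {i j k l : Mink} (h : AdjacentTriangles F i j k l) :
    AdjacentTriangles F i j l k := ⟨h.2.1, h.1, h.2.2.symm⟩

/-- The next ordering of the vertices of a triangle. -/
def Corner.rotate (t : Corner F) : Corner F :=
  ⟨(t.1.2.1, t.1.2.2, t.1.1), by
    have h := t.2
    rw [Set.insert_comm, Set.pair_comm, Set.insert_comm] at h
    convert h using 1
    ext; simp; tauto⟩

/-- The Delaunay condition and the preservation of angles force all radial rates to vanish. -/
theorem radialRate_eq_zero (hΓ : IsClosedSurfaceGroup Γ) (hF : IsGeodesicTriangulation Γ F)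
    (hDel : IsDelaunay F) {η : Mink → Mink}
    (hinv : ∀ γ ∈ Γ, ∀ v ∈ vertices F, ∀ w ∈ vertices F,
      chordRate η (γ v) (γ w) = chordRate η v w)
    (hflux : ∀ i j k l, AdjacentTriangles F i j k l → flux η i j k = flux η i j l)
    {i j k : Mink} (h : ({i, j, k} : Set Mink) ∈ F) : radialRate η i j k = 0 := by
  have := hF.finite_quotient
  choose! opp hopp using fun i j k (h : ({i, j, k} : Set Mink) ∈ F) => hF.exists_adjacent hΓ h
  have hdet : ∀ t : Corner F, det3 t.1.1 t.1.2.1 t.1.2.2 ≠ 0 := fun t => hF.det3_ne_zero t.2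
  have hshift : ∀ γ ∈ Γ, ∀ t : Corner F, triangleShift η (γ t.1.1) (γ t.1.2.1) (γ t.1.2.2)
      = γ (triangleShift η t.1.1 t.1.2.1 t.1.2.2) := by
    intro γ hγ t
    have m1 : t.1.1 ∈ vertices F := ⟨_, t.2, by simp⟩
    have m2 : t.1.2.1 ∈ vertices F := ⟨_, t.2, by simp⟩
    have m3 : t.1.2.2 ∈ vertices F := ⟨_, t.2, by simp⟩
    exact triangleShift_map (hΓ.isometry γ hγ) (hdet t) (hinv γ hγ _ m1 _ m2)
      (hinv γ hγ _ m1 _ m3) (hinv γ hγ _ m2 _ m3)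
  -- The sign of `det3` turns the flux into an outward flow. It makes `σ` invariant under
  -- orientation-reversing elements of `Γ` and odd under passing to the adjacent triangle.
  refine potential_eq_zero (cornerSetoid Γ F)
    (U := fun t => radialRate η t.1.1 t.1.2.1 t.1.2.2)
    (σ := fun t => det3 t.1.1 t.1.2.1 t.1.2.2 * flux η t.1.1 t.1.2.1 t.1.2.2
      / |det3 t.1.1 t.1.2.1 t.1.2.2|)
    (D := fun t => |det3 t.1.1 t.1.2.1 t.1.2.2|) (ρ := Corner.rotate)
    (α := fun t => ⟨(t.1.1, t.1.2.1, opp t.1.1 t.1.2.1 t.1.2.2), (hopp _ _ _ t.2).2.1⟩)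
    (fun t => rfl) ?_ ?_ ?_ ?_ ?_ ?_ ?_ ?_ ?_ ?_ ⟨(i, j, k), h⟩
  · intro t
    apply Subtype.ext
    have h1 := hopp _ _ _ t.2
    have h2 := hopp _ _ _ h1.2.1
    exact Prod.ext rfl (Prod.ext rfl (hF.adjacent_unique h2 h1.symm))
  · rintro s t ⟨γ, hγ, h1, h2, h3⟩
    exact ⟨γ, hγ, h2, h3, h1⟩
  · rintro s t ⟨γ, hγ, h1, h2, h3⟩
    refine ⟨γ, hγ, h1, h2, ?_⟩
    have e1 := hF.adjacent_map hγ (hopp _ _ _ s.2)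
    rw [h1, h2, h3] at e1
    exact hF.adjacent_unique e1 (hopp _ _ _ t.2)
  · rintro s t ⟨γ, hγ, h1, h2, h3⟩
    rw [← h1, ← h2, ← h3, radialRate, radialRate, hshift γ hγ, pole_map (hΓ.isometry γ hγ) (hdet s),
      hΓ.isometry γ hγ]
  · rintro s t ⟨γ, hγ, h1, h2, h3⟩
    rw [← h1, ← h2, ← h3, flux, flux, hshift γ hγ, det3_mul_det3_map (hΓ.isometry γ hγ)]
    congr 1
    rw [← abs_eq_abs.2 (mul_self_eq_mul_self_iff.1
      (det3_mul_det3_map (hΓ.isometry γ hγ) s.1.1 s.1.2.1 s.1.2.2 s.1.1 s.1.2.1 s.1.2.2))]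
  · intro t
    exact abs_pos.2 (hdet t)
  · intro t
    exact radialRate_rotate (hdet t)
  · intro t
    have hs := flux_sum (η := η) (hdet t)
    have r1 := det3_rotate t.1.1 t.1.2.1 t.1.2.2
    have r2 := det3_rotate t.1.2.1 t.1.2.2 t.1.1
    have hne := abs_ne_zero.2 (hdet t)
    simp only [Corner.rotate, r2, r1]
    rw [← add_div, ← add_div, div_eq_iff hne, ← mul_add, ← mul_add, hs]
    have := abs_mul_abs_self (det3 t.1.1 t.1.2.1 t.1.2.2)
    linear_combination radialRate η t.1.1 t.1.2.1 t.1.2.2 * this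
  · intro t
    have ha := hopp _ _ _ t.2
    have hneg := hF.det3_mul_neg ha
    dsimp only
    rw [← hflux _ _ _ _ ha]
    have h1 := hdet t
    have h2 := hF.det3_ne_zero ha.2.1
    rw [← neg_div, div_eq_div_iff (abs_ne_zero.2 h2) (abs_ne_zero.2 h1)]
    rcases h1.lt_or_gt with h | h
    · have h' := pos_of_mul_neg_right hneg h.le
      rw [abs_of_neg h, abs_of_pos h']; ring
    · have h' := neg_of_mul_neg_right hneg h.le
      rw [abs_of_pos h, abs_of_neg h']; ring
  · intro t
    have ha := hopp _ _ _ t.2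
    have hneg := hF.det3_mul_neg ha
    have h1 := hdet t
    have h2 := hF.det3_ne_zero ha.2.1
    have hi : t.1.1 ∈ hypPlane := hF.subset_hypPlane _ t.2 (by simp)
    have hj : t.1.2.1 ∈ hypPlane := hF.subset_hypPlane _ t.2 (by simp)
    have hs := radialRate_sub hi hj h1 h2 (hflux _ _ _ _ ha)
    have hd : mink (pole t.1.1 t.1.2.1 t.1.2.2) (opp t.1.1 t.1.2.1 t.1.2.2) + 1 ≤ 0 := by
      by_contra hc
      exact hDel _ _ _ _ ha ⟨_, (mink_pole h1).1, (mink_pole h1).2.1, (mink_pole h1).2.2,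
        by linarith⟩
    dsimp only
    rw [← mul_div_assoc]
    refine div_nonneg ?_ (abs_nonneg _)
    generalize det3 t.1.1 t.1.2.1 t.1.2.2 = a at *
    generalize det3 t.1.1 t.1.2.1 (opp t.1.1 t.1.2.1 t.1.2.2) = b at *
    generalize flux η t.1.1 t.1.2.1 t.1.2.2 = s at *
    generalize radialRate η t.1.1 t.1.2.1 t.1.2.2
      - radialRate η t.1.1 t.1.2.1 (opp t.1.1 t.1.2.1 t.1.2.2) = u at *
    generalize mink (pole t.1.1 t.1.2.1 t.1.2.2) (opp t.1.1 t.1.2.1 t.1.2.2) + 1 = d at *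
    have h3 : (u * (a * s)) * (b * b) = (d * (a * b)) * (s * s) := by
      linear_combination (a * b * s) * hs
    have h4 : 0 ≤ (d * (a * b)) * (s * s) :=
      mul_nonneg (mul_nonneg_of_nonpos_of_nonpos hd hneg.le) (mul_self_nonneg s)
    rw [← h3] at h4
    exact nonneg_of_mul_nonneg_left h4 (mul_self_pos.2 h2)

/-- All fluxes vanish: look at a shortest edge with a flux different from zero. -/
theorem flux_eq_zero (hΓ : IsClosedSurfaceGroup Γ) (hF : IsGeodesicTriangulation Γ F)
    (hDel : IsDelaunay F) {η : Mink → Mink}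
    (hinv : ∀ γ ∈ Γ, ∀ v ∈ vertices F, ∀ w ∈ vertices F,
      chordRate η (γ v) (γ w) = chordRate η v w)
    (hflux : ∀ i j k l, AdjacentTriangles F i j k l → flux η i j k = flux η i j l)
    {i j k : Mink} (h : ({i, j, k} : Set Mink) ∈ F) : flux η i j k = 0 := by
  by_contra hne
  have := hF.finite_quotient
  -- A larger Minkowski product means a shorter edge; the maximum exists because there are finitely
  -- many orbits of corners.
  have hmax : ∃ i j k, ({i, j, k} : Set Mink) ∈ F ∧ flux η i j k ≠ 0 ∧
      ∀ i' j' k', ({i', j', k'} : Set Mink) ∈ F → flux η i' j' k' ≠ 0 →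
        mink i' j' ≤ mink i j := by
    obtain ⟨q, hq, hqmax⟩ := Set.exists_max_image
      {q : Quotient (cornerSetoid Γ F) | ∃ t : Corner F, ⟦t⟧ = q ∧
        flux η t.1.1 t.1.2.1 t.1.2.2 ≠ 0}
      (fun q => mink q.out.1.1 q.out.1.2.1) (Set.toFinite _) ⟨⟦⟨(i, j, k), h⟩⟧, _, rfl, hne⟩
    have hout : ∀ t : Corner F, mink (Quotient.mk (cornerSetoid Γ F) t).out.1.1
        (Quotient.mk (cornerSetoid Γ F) t).out.1.2.1 = mink t.1.1 t.1.2.1 := by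
      intro t
      obtain ⟨γ, hγ, h1, h2, -⟩ := Quotient.exact (Quotient.out_eq
        (Quotient.mk (cornerSetoid Γ F) t))
      rw [← h1, ← h2, hΓ.isometry γ hγ]
    obtain ⟨t, rfl, ht⟩ := hq
    refine ⟨t.1.1, t.1.2.1, t.1.2.2, t.2, ht, ?_⟩
    intro i' j' k' h' hne'
    have := hqmax ⟦⟨(i', j', k'), h'⟩⟧ ⟨_, rfl, hne'⟩
    rwa [hout, hout] at this
  clear hne h i j k
  obtain ⟨i, j, k, h, hne, hmax⟩ := hmax
  -- Opposite a non-acute angle, `ij` is strictly longest, so the other two edges carry no flux, and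
  -- the total is zero.
  have hacute : ∀ k, ({i, j, k} : Set Mink) ∈ F → flux η i j k ≠ 0 →
      ¬ mink (i - k) (j - k) ≤ 0 := by
    intro k h hne hle
    have hdet := hF.det3_ne_zero h
    obtain ⟨-, hik, hjk⟩ := ne_of_det3_ne_zero hdet
    have hH := hF.subset_hypPlane _ h
    obtain ⟨l1, l2⟩ := mink_lt_of_not_acute (hH (by simp)) (hH (by simp)) (hH (by simp)) hik hjk hle
    have hsum := flux_sum (η := η) hdet
    rw [radialRate_eq_zero hΓ hF hDel hinv hflux h, mul_zero] at hsum
    have h1 : ({j, k, i} : Set Mink) ∈ F := (Corner.rotate ⟨(i, j, k), h⟩).2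
    have h2 : ({k, i, j} : Set Mink) ∈ F := (Corner.rotate ⟨(j, k, i), h1⟩).2
    have z1 : flux η j k i = 0 := by
      by_contra hc
      exact absurd (hmax _ _ _ h1 hc) (not_le.2 l1)
    have z2 : flux η k i j = 0 := by
      by_contra hc
      exact absurd (hmax _ _ _ h2 hc) (not_le.2 l2)
    rw [z1, z2] at hsum
    apply hne
    linarith
  obtain ⟨l, hl⟩ := hF.exists_adjacent hΓ h
  have hdk := hF.det3_ne_zero h
  have hdl := hF.det3_ne_zero hl.2.1
  have hfl := hflux _ _ _ _ hl
  have hH := hF.subset_hypPlane _ h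
  have hlH : l ∈ hypPlane := hF.subset_hypPlane _ hl.2.1 (by simp)
  -- Without a jump of the radial rate, a nonzero flux forces `⟨o,l⟩ = -1`: the four vertices are
  -- concyclic.
  have hs := radialRate_sub (hH (by simp)) (hH (by simp)) hdk hdl hfl
  rw [radialRate_eq_zero hΓ hF hDel hinv hflux h,
    radialRate_eq_zero hΓ hF hDel hinv hflux hl.2.1, sub_zero, zero_mul, eq_comm,
    mul_eq_zero, or_iff_left hne] at hs
  obtain ⟨p1, p2, p3⟩ := mink_pole hdk
  rcases exists_not_acute (hH (by simp)) (hH (by simp)) (hH (by simp)) hlH p1 p2 p3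
    (by linarith) (hF.det3_mul_neg hl) with hc | hc
  · exact hacute k h hne hc
  · exact hacute l hl.2.1 (hfl ▸ hne) hc

end Triangulation

/-! ### Killing fields -/

/-- Infinitesimal congruence of a triangle extends to an infinitesimal isometry. -/
theorem exists_infinitesimalIsometry {i j k : Mink} (h : det3 i j k ≠ 0) {ξ : Mink → Mink}
    (ti : mink (ξ i) i = 0) (tj : mink (ξ j) j = 0) (tk : mink (ξ k) k = 0)
    (hij : mink (ξ i) j + mink i (ξ j) = 0) (hik : mink (ξ i) k + mink i (ξ k) = 0)
    (hjk : mink (ξ j) k + mink j (ξ k) = 0) :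
    ∃ B : Mink →ₗ[ℝ] Mink, IsInfinitesimalIsometry B ∧ B i = ξ i ∧ B j = ξ j ∧ B k = ξ k := by
  let B : Mink →ₗ[ℝ] Mink :=
    { toFun := fun x => (det3 i j k)⁻¹ •
        (det3 x j k • ξ i + det3 i x k • ξ j + det3 i j x • ξ k)
      map_add' := fun x y => by
        have e1 : det3 (x + y) j k = det3 x j k + det3 y j k := by simp [det3]; ring
        have e2 : det3 i (x + y) k = det3 i x k + det3 i y k := by simp [det3]; ring
        have e3 : det3 i j (x + y) = det3 i j x + det3 i j y := by simp [det3]; ring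
        rw [e1, e2, e3]; module
      map_smul' := fun a x => by
        have e1 : det3 (a • x) j k = a * det3 x j k := by simp [det3]; ring
        have e2 : det3 i (a • x) k = a * det3 i x k := by simp [det3]; ring
        have e3 : det3 i j (a • x) = a * det3 i j x := by simp [det3]; ring
        rw [e1, e2, e3, RingHom.id_apply]; module }
  have hB : ∀ x, det3 i j k • B x = det3 x j k • ξ i + det3 i x k • ξ j + det3 i j x • ξ k := by
    intro x
    change det3 i j k • ((det3 i j k)⁻¹ •
      (det3 x j k • ξ i + det3 i x k • ξ j + det3 i j x • ξ k)) = _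
    rw [smul_smul, mul_inv_cancel₀ h, one_smul]
  refine ⟨B, ?_, ?_, ?_, ?_⟩
  · intro x y
    have e : det3 i j k * det3 i j k * (mink (B x) y + mink x (B y))
        = mink (det3 i j k • B x) (det3 i j k • y) + mink (det3 i j k • x) (det3 i j k • B y) := by
      simp only [mink_smul_left, mink_smul_right]; ring
    rw [hB, hB, det3_smul_eq i j k x, det3_smul_eq i j k y] at e
    simp only [mink_add_left, mink_add_right, mink_smul_left, mink_smul_right, ti, tj, tk,
      mink_comm _ (ξ i), mink_comm _ (ξ j), mink_comm _ (ξ k)] at e hij hik hjk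
    generalize det3 x j k = a at *
    generalize det3 i x k = b at *
    generalize det3 i j x = c at *
    generalize det3 y j k = a' at *
    generalize det3 i y k = b' at *
    generalize det3 i j y = c' at *
    have : det3 i j k * det3 i j k * (mink (B x) y + mink x (B y)) = 0 := by
      rw [e]
      linear_combination (a * b' + b * a') * hij + (a * c' + c * a') * hik
        + (b * c' + c * b') * hjk
    exact (mul_eq_zero.1 this).resolve_left (mul_ne_zero h h)
  · apply smul_right_injective _ h
    have e1 : det3 i i k = 0 := by simp only [det3]; ring
    have e2 : det3 i j i = 0 := by simp only [det3]; ring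
    simp [hB, e1, e2]
  · apply smul_right_injective _ h
    have e1 : det3 j j k = 0 := by simp only [det3]; ring
    have e2 : det3 i j j = 0 := by simp only [det3]; ring
    simp [hB, e1, e2]
  · apply smul_right_injective _ h
    have e1 : det3 k j k = 0 := by simp only [det3]; ring
    have e2 : det3 i k k = 0 := by simp only [det3]; ring
    simp [hB, e1, e2]

theorem linearMap_eq_of_basis {i j k : Mink} (h : det3 i j k ≠ 0) {B C : Mink →ₗ[ℝ] Mink}
    (hi : B i = C i) (hj : B j = C j) (hk : B k = C k) : B = C := by
  refine LinearMap.ext fun x => ?_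
  apply smul_right_injective _ h
  simp only
  rw [← map_smul, ← map_smul, det3_smul_eq]
  simp only [map_add, map_smul, hi, hj, hk]

/-- An infinitesimal isometry is determined by its values at two points. -/
theorem infinitesimalIsometry_eq {i j k : Mink} (h : det3 i j k ≠ 0) {B C : Mink →ₗ[ℝ] Mink}
    (hB : IsInfinitesimalIsometry B) (hC : IsInfinitesimalIsometry C) (hi : B i = C i)
    (hj : B j = C j) : B = C := by
  refine linearMap_eq_of_basis h hi hj (eq_of_mink_eq h ?_ ?_ ?_)
  · have h1 := hB k i
    have h2 := hC k i
    rw [hi] at h1; linarith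
  · have h1 := hB k j
    have h2 := hC k j
    rw [hj] at h1; linarith
  · have h1 := hB k k
    have h2 := hC k k
    rw [mink_comm k] at h1 h2; linarith

theorem eq_zero_of_forall_mul_sq_le {a C : ℝ} (ha : 0 ≤ a) (h : ∀ s : ℝ, a * s ^ 2 ≤ C) :
    a = 0 := by
  by_contra hne
  have hpos : 0 < a := ha.lt_of_ne (Ne.symm hne)
  have h1 := h (Real.sqrt ((|C| + 1) / a))
  rw [Real.sq_sqrt (by positivity), mul_div_cancel₀ _ hpos.ne'] at h1
  linarith [le_abs_self C]

/-- A Killing field of bounded length vanishes. -/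
theorem infinitesimalIsometry_eq_zero {B : Mink →ₗ[ℝ] Mink} (hB : IsInfinitesimalIsometry B)
    {C : ℝ} (hC : ∀ x ∈ hypPlane, mink (B x) (B x) ≤ C) : B = 0 := by
  have hdecomp : ∀ x : Mink, x = x 0 • ![1, 0, 0] + x 1 • ![0, 1, 0] + x 2 • ![0, 0, 1] := by
    intro x
    ext n
    fin_cases n <;> simp
  have b00 := hB ![1, 0, 0] ![1, 0, 0]
  have b01 := hB ![1, 0, 0] ![0, 1, 0]
  have b02 := hB ![1, 0, 0] ![0, 0, 1]
  have b11 := hB ![0, 1, 0] ![0, 1, 0]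
  have b12 := hB ![0, 1, 0] ![0, 0, 1]
  have b22 := hB ![0, 0, 1] ![0, 0, 1]
  simp [mink] at b00 b01 b02 b11 b12 b22
  have hBx : ∀ x : Mink, B x = x 0 • B ![1, 0, 0] + x 1 • B ![0, 1, 0] + x 2 • B ![0, 0, 1] := by
    intro x
    conv_lhs => rw [hdecomp x]
    simp only [map_add, map_smul]
  generalize B ![1, 0, 0] = u at *
  generalize B ![0, 1, 0] = v at *
  generalize B ![0, 0, 1] = w at *
  have hu0 : u 0 = 0 := by linarith
  have hv0 : v 0 = u 1 := by linarith
  have hw0 : w 0 = u 2 := by linarith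
  have hv1 : v 1 = 0 := by linarith
  have hw1 : w 1 = -v 2 := by linarith
  have hw2 : w 2 = 0 := by linarith
  -- Adding the bounds at the opposite points `s` and `-s` cancels the mixed term, leaving quadratic
  -- growth in `s`.
  have key1 : ∀ s : ℝ, (u 2 ^ 2 + v 2 ^ 2) * s ^ 2 ≤ C := by
    intro s
    have h1 := hC _ (hypChart_mem (s, 0))
    have h2 := hC _ (hypChart_mem (-s, 0))
    rw [hBx] at h1 h2
    have hs : Real.sqrt (1 + s ^ 2) * Real.sqrt (1 + s ^ 2) = 1 + s ^ 2 :=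
      Real.mul_self_sqrt (by positivity)
    simp [mink, hypChart, hu0, hv0, hv1] at h1 h2
    generalize Real.sqrt (1 + s ^ 2) = X at *
    nlinarith [sq_nonneg (u 1), sq_nonneg (u 2)]
  have key2 : ∀ s : ℝ, u 1 ^ 2 * s ^ 2 ≤ C := by
    intro s
    have h1 := hC _ (hypChart_mem (0, s))
    have h2 := hC _ (hypChart_mem (0, -s))
    rw [hBx] at h1 h2
    have hs : Real.sqrt (1 + s ^ 2) * Real.sqrt (1 + s ^ 2) = 1 + s ^ 2 :=
      Real.mul_self_sqrt (by positivity)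
    simp [mink, hypChart, hu0, hw0, hw1, hw2] at h1 h2
    generalize Real.sqrt (1 + s ^ 2) = X at *
    nlinarith [sq_nonneg (u 1), sq_nonneg (u 2), mul_self_nonneg (v 2 * s)]
  have z1 := eq_zero_of_forall_mul_sq_le (by positivity) key1
  have z2 := eq_zero_of_forall_mul_sq_le (by positivity) key2
  have u2 : u 2 = 0 := by nlinarith [sq_nonneg (u 2), sq_nonneg (v 2)]
  have v2 : v 2 = 0 := by nlinarith [sq_nonneg (u 2), sq_nonneg (v 2)]
  have u1 : u 1 = 0 := by nlinarith
  refine LinearMap.ext fun x => ?_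
  rw [hBx]
  ext n
  fin_cases n <;> simp [hu0, hv0, hw0, hv1, hw1, hw2, u2, v2, u1]

section Triangulation

variable {Γ : Subgroup (Mink ≃ₗ[ℝ] Mink)} {F : Set (Set Mink)}

/-- A closed hyperbolic surface has no Killing fields. -/
theorem IsClosedSurfaceGroup.infinitesimalIsometry_eq_zero (hΓ : IsClosedSurfaceGroup Γ)
    {B : Mink →ₗ[ℝ] Mink} (hB : IsInfinitesimalIsometry B) (h : ∀ γ ∈ Γ, ∀ x, B (γ x) = γ (B x)) :
    B = 0 := by
  obtain ⟨K, hK, -, hcov⟩ := hΓ.cocompact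
  have hc : Continuous fun x => mink (B x) (B x) := by
    have := B.continuous_of_finiteDimensional
    unfold mink
    fun_prop
  obtain ⟨C, hC⟩ := hK.exists_bound_of_continuousOn hc.continuousOn
  refine CirclePattern.infinitesimalIsometry_eq_zero hB (C := C) fun x hx => ?_
  obtain ⟨γ, hγ, hm⟩ := hcov x hx
  have := (le_abs_self _).trans (hC _ hm)
  rwa [h γ hγ, hΓ.isometry γ hγ] at this

theorem mink_sub_killing_add {η : Mink → Mink} {A : Mink →ₗ[ℝ] Mink} (hA : IsInfinitesimalIsometry A)
    (v w : Mink) : mink (η v - A v) w + mink v (η w - A w) = mink (η v) w + mink v (η w) := by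
  rw [mink_sub_left, mink_sub_right]
  linarith [hA v w]

/-- Chord rates do not see Killing fields, so `η` may be replaced by the equivariant field `η - A`.
-/
theorem chordRate_map (hΓ : IsClosedSurfaceGroup Γ) {η : Mink → Mink} {A : Mink →ₗ[ℝ] Mink}
    (hA : IsInfinitesimalIsometry A) (hstr : PreservesHyperbolicStructure Γ F A η) :
    ∀ γ ∈ Γ, ∀ v ∈ vertices F, ∀ w ∈ vertices F,
      chordRate η (γ v) (γ w) = chordRate η v w := by
  intro γ hγ v hv w hw
  rw [chordRate, chordRate, hΓ.isometry γ hγ, ← mink_sub_killing_add hA, hstr γ hγ v hv,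
    hstr γ hγ w hw, hΓ.isometry γ hγ, hΓ.isometry γ hγ, mink_sub_killing_add hA]

end Triangulation

end CirclePattern

/-! ### Rigidity -/

open CirclePattern in
theorem mainTheorem7
    (Γ : Subgroup (CirclePattern.Mink ≃ₗ[ℝ] CirclePattern.Mink))
    (hΓ : CirclePattern.IsClosedSurfaceGroup Γ)
    (F : Set (Set CirclePattern.Mink))
    (hF : CirclePattern.IsGeodesicTriangulation Γ F)
    (hDel : CirclePattern.IsDelaunay F)
    (η : CirclePattern.Mink → CirclePattern.Mink)
    (hη : CirclePattern.IsTangentField F η)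
    (A : CirclePattern.Mink →ₗ[ℝ] CirclePattern.Mink)
    (hA : CirclePattern.IsInfinitesimalIsometry A)
    (hstr : CirclePattern.PreservesHyperbolicStructure Γ F A η)
    (hang : CirclePattern.PreservesIntersectionAngles F η) :
    ∀ v ∈ CirclePattern.vertices F, η v = A v := by
  have hinv := chordRate_map hΓ hA hstr
  have hflux : ∀ i j k l, AdjacentTriangles F i j k l → flux η i j k = flux η i j l :=
    fun i j k l h => flux_eq_of_preservesIntersectionAngles hF.vertices_subset hη hang h
      (hF.det3_ne_zero h.1) (hF.det3_ne_zero h.2.1)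
  have htan : ∀ v ∈ vertices F, mink (η v - A v) v = 0 := by
    intro v hv
    have := hA v v
    rw [mink_comm v] at this
    rw [mink_sub_left, hη v hv]
    linarith
  have hface : ∀ f ∈ F, ∃ B : Mink →ₗ[ℝ] Mink, IsInfinitesimalIsometry B ∧
      ∀ v ∈ f, B v = η v - A v := by
    intro f hf
    obtain ⟨i, j, k, rfl⟩ := hF.exists_eq_triple hf
    have hdet := hF.det3_ne_zero hf
    have h1 : ({j, k, i} : Set Mink) ∈ F := (Corner.rotate ⟨(i, j, k), hf⟩).2
    have h2 : ({k, i, j} : Set Mink) ∈ F := (Corner.rotate ⟨(j, k, i), h1⟩).2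
    -- A zero shift makes all chord rates zero, so `η - A` is an infinitesimal congruence of the
    -- triangle.
    have hz := triangleShift_eq_zero hdet (flux_eq_zero hΓ hF hDel hinv hflux hf)
      (flux_eq_zero hΓ hF hDel hinv hflux h1) (flux_eq_zero hΓ hF hDel hinv hflux h2)
    obtain ⟨c1, c2, c3⟩ := mink_triangleShift (η := η) hdet
    simp only [hz, mink_zero_left, add_zero] at c1 c2 c3
    obtain ⟨n1, n2, n3⟩ := ne_of_det3_ne_zero hdet
    have hH := hF.subset_hypPlane _ hf
    have hi : i ∈ hypPlane := hH (by simp)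
    have hj : j ∈ hypPlane := hH (by simp)
    have hk : k ∈ hypPlane := hH (by simp)
    have hrate : ∀ v ∈ hypPlane, ∀ w ∈ hypPlane, v ≠ w → 0 = chordRate η v w →
        mink (η v - A v) w + mink v (η w - A w) = 0 := by
      intro v hv w hw hvw h0
      rw [mink_sub_killing_add hA]
      rw [chordRate, eq_comm, div_eq_zero_iff] at h0
      refine h0.resolve_right ?_
      linarith [mink_lt_neg_one hv hw hvw]
    obtain ⟨B, hB, b1, b2, b3⟩ := exists_infinitesimalIsometry hdet (ξ := fun v => η v - A v)
      (htan i ⟨_, hf, by simp⟩) (htan j ⟨_, hf, by simp⟩) (htan k ⟨_, hf, by simp⟩)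
      (hrate i hi j hj n1 c1) (hrate i hi k hk n2 c2) (hrate j hj k hk n3 c3)
    refine ⟨B, hB, ?_⟩
    rintro v (rfl | rfl | rfl)
    · exact b1
    · exact b2
    · exact b3
  choose! B hBiso hBval using hface
  have hconst : ∀ f ∈ F, ∀ g ∈ F, B f = B g := by
    intro f hf g hg
    refine hF.eq_of_adjacent hΓ B ?_ hf hg
    intro i j k l h
    refine infinitesimalIsometry_eq (hF.det3_ne_zero h.1) (hBiso _ h.1) (hBiso _ h.2.1) ?_ ?_
    · rw [hBval _ h.1 i (by simp), hBval _ h.2.1 i (by simp)]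
    · rw [hBval _ h.1 j (by simp), hBval _ h.2.1 j (by simp)]
  rintro v ⟨f, hf, hv⟩
  have hval : ∀ w ∈ vertices F, B f w = η w - A w := by
    rintro w ⟨g, hg, hw⟩
    rw [hconst f hf g hg, hBval g hg w hw]
  have hB0 : B f = 0 := by
    refine hΓ.infinitesimalIsometry_eq_zero (hBiso f hf) fun γ hγ x => ?_
    -- Equivariance of `η - A` at the vertices of one triangle suffices, since they form a basis.
    have hcomm : ∀ w ∈ f, B f (γ w) = γ (B f w) := by
      intro w hw
      have hγw : γ w ∈ vertices F := ⟨_, hF.invariant γ hγ f hf, w, hw, rfl⟩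
      rw [hval _ hγw, hval w ⟨f, hf, hw⟩, hstr γ hγ w ⟨f, hf, hw⟩]
    obtain ⟨i, j, k, rfl⟩ := hF.exists_eq_triple hf
    exact LinearMap.congr_fun (linearMap_eq_of_basis (hF.det3_ne_zero hf)
      (B := B {i, j, k} ∘ₗ (γ : Mink →ₗ[ℝ] Mink)) (C := (γ : Mink →ₗ[ℝ] Mink) ∘ₗ B {i, j, k})
      (hcomm i (by simp)) (hcomm j (by simp)) (hcomm k (by simp))) x
  have := hBval f hf v hv
  rw [hB0, LinearMap.zero_apply] at this
  exact (sub_eq_zero.1 this.symm)
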